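/- Let $k$ be a global function field with finite constant field $\mathbb F_q$ (finitely generated of transcendence degree one over $\mathbb F_q$, with $\mathbb F_q$ algebraically closed in $k$). Fix a place $\infty$ of $k$; let $A\subset k$ be the ring of functions regular away from $\infty$, $k_\infty$ the completion of $k$ at $\infty$, and $\mathbb C_\infty$ the completion of an algebraic closure of $k_\infty$, with the absolute value $|\cdot|_\infty$ extending $|x|_\infty=q_\infty^{-\operatorname{ord}_\infty(x)}$ on $k$, where $q_\infty$ is the cardinality of the residue field at $\infty$. Let $r\ge 1$, let $Y\subset k^r$ be a projective $A$-module of rank $r$, and let $z=(z_1:\dots:z_{r-1}:1)\in\mathbb P^{r-1}(\mathbb C_\infty)$ be a point lying on no $k_\infty$-rational hyperplane. Put $$\Lambda=\Lambda^Y_z=\{y_1z_1+\dots+y_{r-1}z_{r-1}+y_r:(y_1,\dots,y_r)\in Y\},$$ $$\operatorname{Im}(z)=\prod_{i=1}^{r-1}\ \inf_{u_{i+1},\dots,u_r\in k_\infty}\Big|z_i+\sum_{j=i+1}^{r-1}u_jz_j+u_r\Big|_\infty .$$ Then every ball in $\mathbb C_\infty$ contains only finitely many elements of $\Lambda$. The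 series $$\mathbb E^Y(z,s)=\sum_{0\ne\lambda\in\Lambda}\frac{\operatorname{Im}(z)^s}{|\lambda|_\infty^{rs}}$$ converges absolutely for $\operatorname{Re}(s)>1$ and has a unique meromorphic continuation to $\mathbb C$, again denoted by $\mathbb E^Y(z,s)$. For every $a\in A\setminus\mathbb F_q$ the following hold. (1) The group $\tfrac1a\Lambda/\Lambda$ is finite, and for every choice of representatives $w$ of its nonzero classes and every $s\in\mathbb C$ with $|a|_\infty^{rs}\ne|a|_\infty^r$, $$\mathbb E^Y(z,s)=\frac{\operatorname{Im}(z)^s}{|a|_\infty^{rs}-|a|_\infty^r}\sum_{0\ne w\in\frac1a\Lambda/\Lambda}\Bigg[\frac1{|w|_\infty^{rs}}+\sum_{\substack{0\ne\lambda\in\Lambda\\|\lambda|_\infty\le|w|_\infty}}\bigg(\frac1{|\lambda-w|_\infty^{rs}}-\frac1{|\lambda|_\infty^{rs}}\bigg)\Bigg].$$ (2) The group $\Lambda/a\Lambda$ is finite, the function $\big(1-|a|_\infty^{r(1-s)}\big)\operatorname{Im}(z)^{-s}\,\mathbb E^Y(z,s)$ is analytic at $s=0$, and for every choice of representatives $w$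 of the nonzero classes of $\Lambda/a\Lambda$ and every integer $n\ge0$, $$\frac{\partial^n}{\partial s^n}\bigg(\frac{1-|a|_\infty^{r(1-s)}}{\operatorname{Im}(z)^s}\,\mathbb E^Y(z,s)\bigg)\bigg|_{s=0}=(-r)^n\sum_{0\ne w\in\Lambda/a\Lambda}\Bigg[\ln^n|w|_\infty+\sum_{\substack{0\ne\lambda\in a\Lambda\\|\lambda|_\infty\le|w|_\infty}}\Big(\ln^n|\lambda-w|_\infty-\ln^n|\lambda|_\infty\Big)\Bigg],$$ where $\ln^n x=(\ln x)^n$. -/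

import Mathlib

noncomputable section

namespace DrinfeldEisenstein

open scoped WithZero NNReal

/-- A place of a field `k`: a normalized (i.e. surjective) discrete valuation
`k → ℤᵐ⁰ = ℤ ∪ {-∞}`, written multiplicatively, so that `val x = exp (-ord x)` for `x ≠ 0`.
Over a function field with finite constant field each valuation is trivial on the constants,
so these are exactly the places in the usual sense. -/
structure Place (k : Type*) [Field k] where
  val : Valuation k ℤᵐ⁰
  surj : Function.Surjective val

section Basic

variable {k : Type*} [Field k]

namespace Place

/-- The cardinality `q_v` of the residue field at `v`. -/
def q (v : Place k) : ℕ := Nat.card (IsLocalRing.ResidueField v.val.valuationSubring)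

/-- The base of the normalized absolute value, which is `q_v`. Places of global function fields have
finite residue fields, so `2 ≤ q_v`, and the maximum only makes the definition total. -/
def base (v : Place k) : ℝ≥0 := max 2 (v.q : ℝ≥0)

theorem one_lt_base (v : Place k) : 1 < v.base :=
  lt_of_lt_of_le one_lt_two (le_max_left _ _)

theorem abs_add_le_max (v : Place k) (x y : k) :
    WithZeroMulInt.toNNReal v.one_lt_base.ne_zero (v.val (x + y)) ≤
      max (WithZeroMulInt.toNNReal v.one_lt_base.ne_zero (v.val x))
        (WithZeroMulInt.toNNReal v.one_lt_base.ne_zero (v.val y)) := by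
  have h := (WithZeroMulInt.toNNReal_strictMono v.one_lt_base).monotone
  rw [← h.map_max]
  exact h (v.val.map_add x y)

/-- The normalized absolute value `|x|_v = q_v ^ (-ord_v x)`. -/
def abs (v : Place k) : AbsoluteValue k ℝ where
  toFun x := (WithZeroMulInt.toNNReal v.one_lt_base.ne_zero (v.val x) : ℝ≥0)
  map_mul' x y := by simp
  nonneg' x := NNReal.coe_nonneg _
  eq_zero' x := by simp
  add_le' x y := by
    rw [← NNReal.coe_add, NNReal.coe_le_coe]
    exact (v.abs_add_le_max x y).trans (max_le_add_of_nonneg zero_le zero_le)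

/-- The ring `A` of functions in `k` that are regular away from the place `v = ∞`. -/
def ringAway (v : Place k) : Subring k :=
  ⨅ w : {w : Place k // w ≠ v}, w.1.val.valuationSubring.toSubring

/-- The completion `k_∞` of `k` at `v = ∞`, with the norm extending `|·|_∞`. -/
abbrev KInf (v : Place k) : Type _ := v.abs.Completion

instance isUltrametricDist_KInf (v : Place k) : IsUltrametricDist v.KInf := by
  refine IsUltrametricDist.isUltrametricDist_of_forall_norm_add_le_max_norm fun x y => ?_
  induction x, y using UniformSpace.Completion.induction_on₂ with
  | hp => exact isClosed_le (by fun_prop) (by fun_prop)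
  | ih a b =>
    rw [← UniformSpace.Completion.coe_add, UniformSpace.Completion.norm_coe,
      UniformSpace.Completion.norm_coe, UniformSpace.Completion.norm_coe]
    exact_mod_cast v.abs_add_le_max a.ofAbs b.ofAbs

instance nontriviallyNormedField_KInf (v : Place k) : NontriviallyNormedField v.KInf where
  non_trivial := by
    obtain ⟨x, hx⟩ := v.surj (WithZero.exp 1)
    refine ⟨((WithAbs.toAbs v.abs x : WithAbs v.abs) : v.KInf), ?_⟩
    rw [UniformSpace.Completion.norm_coe, WithAbs.norm_toAbs_eq]
    have h := WithZeroMulInt.toNNReal_strictMono v.one_lt_base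
      (show (1 : ℤᵐ⁰) < v.val x by rw [hx, ← WithZero.exp_zero]; exact WithZero.exp_lt_exp.2 one_pos)
    rw [map_one] at h
    exact_mod_cast h

/-- The norm on the algebraic closure of `k_∞` that extends the norm of `k_∞`. -/
instance normedField_algClosure (v : Place k) : NormedField (AlgebraicClosure v.KInf) :=
  spectralNorm.normedField v.KInf (AlgebraicClosure v.KInf)

instance normedAlgebra_algClosure (v : Place k) :
    NormedAlgebra v.KInf (AlgebraicClosure v.KInf) :=
  spectralNorm.normedAlgebra v.KInf (AlgebraicClosure v.KInf)

/-- `ℂ_∞`, the completion of an algebraic closure of `k_∞`. -/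
abbrev CInf (v : Place k) : Type _ := UniformSpace.Completion (AlgebraicClosure v.KInf)

/-- The embedding `k_∞ → ℂ_∞`. -/
def embInf (v : Place k) : v.KInf →+* v.CInf :=
  (algebraMap (AlgebraicClosure v.KInf) v.CInf).comp
    (algebraMap v.KInf (AlgebraicClosure v.KInf))

/-- The embedding `k → ℂ_∞`. -/
def emb (v : Place k) : k →+* v.CInf :=
  v.embInf.comp (algebraMap k v.KInf)

end Place

section Period

variable (v : Place k) (r : ℕ) [NeZero r]

/-- The last index of an `r`-tuple. -/
def lastIdx : Fin r := ⟨r - 1, Nat.sub_lt (Nat.pos_of_ne_zero (NeZero.ne r)) one_pos⟩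

/-- The Drinfeld period domain of rank `r`: the points of `ℙ^{r-1}(ℂ_∞)` that lie on no
`k_∞`-rational hyperplane. -/
def periodDomain : Set (Projectivization v.CInf (Fin r → v.CInf)) :=
  {z | ∀ c : Fin r → v.KInf, c ≠ 0 → ∑ i, v.embInf (c i) * z.rep i ≠ 0}

variable {v r}

/-- The representative `(z_1, …, z_{r-1}, 1)` of a point `z` of the period domain. -/
def coord (z : Projectivization v.CInf (Fin r → v.CInf)) (i : Fin r) : v.CInf :=
  z.rep i / z.rep (lastIdx r)

/-- The `i`-th imaginary part: the infimum of `|z_i + ∑_{j > i} u_j z_j|_∞` over `u_j ∈ k_∞`,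
where `z_r = 1`. -/
def imPart (z : Projectivization v.CInf (Fin r → v.CInf)) (i : Fin r) : ℝ :=
  ⨅ u : Fin r → v.KInf, ‖coord z i + ∑ j ∈ Finset.Ioi i, v.embInf (u j) * coord z j‖

/-- The total imaginary part: the product of the `i`-th imaginary parts for `1 ≤ i < r`. -/
def totalIm (z : Projectivization v.CInf (Fin r → v.CInf)) : ℝ :=
  ∏ i ∈ Finset.Iio (lastIdx r), imPart z i

/-- The map `(x_1, …, x_r) ↦ x_1 z_1 + ⋯ + x_{r-1} z_{r-1} + x_r` from `k^r` to `ℂ_∞`. -/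
def evalMap (z : Projectivization v.CInf (Fin r → v.CInf)) : (Fin r → k) →+ v.CInf where
  toFun x := ∑ i, v.emb (x i) * coord z i
  map_zero' := by simp
  map_add' x y := by simp [add_mul, Finset.sum_add_distrib]

/-- The lattice `Λ^Y_z`. -/
def lattice (Y : Submodule v.ringAway (Fin r → k))
    (z : Projectivization v.CInf (Fin r → v.CInf)) : AddSubgroup v.CInf :=
  Y.toAddSubgroup.map (evalMap z)

/-- The term of the Eisenstein series at a lattice element `l`: `Im(z)^s / |l|_∞^{rs}`. -/
def eisTerm (z : Projectivization v.CInf (Fin r → v.CInf)) (s : ℂ) (l : v.CInf) : ℂ :=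
  (totalIm z : ℂ) ^ s / (‖l‖ : ℂ) ^ ((r : ℂ) * s)

/-- `E` is the meromorphic continuation of the Eisenstein series `E^Y(z, ·)` to the complex plane:
it is meromorphic on `ℂ`, it is given by the series for `Re s > 1`, and (normal form) it has no
removable singularities, its value at each pole being set to `0`. -/
def IsEisenstein (Y : Submodule v.ringAway (Fin r → k))
    (z : Projectivization v.CInf (Fin r → v.CInf)) (E : ℂ → ℂ) : Prop :=
  MeromorphicNFOn E Set.univ ∧
    ∀ s : ℂ, 1 < s.re → E s = ∑' l : {l : v.CInf // l ∈ lattice Y z ∧ l ≠ 0}, eisTerm z s l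

end Period

/-- The subgroup `a L` of `ℂ_∞`. -/
def mulLattice {v : Place k} (a : k) (L : AddSubgroup v.CInf) : AddSubgroup v.CInf :=
  L.map (AddMonoidHom.mulLeft (v.emb a))

/-- The subgroup `(1/a) L = {w | a w ∈ L}` of `ℂ_∞` (for `a ≠ 0`). -/
def divLattice {v : Place k} (a : k) (L : AddSubgroup v.CInf) : AddSubgroup v.CInf :=
  L.comap (AddMonoidHom.mulLeft (v.emb a))

/-- The quotient `M / L` of subgroups `L ⊆ M` of `ℂ_∞`. -/
abbrev LatQuot {v : Place k} (M L : AddSubgroup v.CInf) : Type _ := M ⧸ L.addSubgroupOf M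

/-- The expression `f(|w|) + ∑ (f(|l - w|) - f(|l|))`, where `l` ranges over the nonzero elements
of `L` with `|l| ≤ |w|`. -/
def bracket {v : Place k} (L : AddSubgroup v.CInf) (f : ℝ → ℂ) (w : v.CInf) : ℂ :=
  f ‖w‖ + ∑ᶠ l ∈ {l : v.CInf | l ∈ L ∧ l ≠ 0 ∧ ‖l‖ ≤ ‖w‖}, (f ‖l - w‖ - f ‖l‖)

/-- The sum of `bracket L f w` over the nonzero classes of `M / L`, where `σ` picks a
representative `w` of each class. -/
def cosetSum {v : Place k} (M L : AddSubgroup v.CInf) (σ : LatQuot M L → M) (f : ℝ → ℂ) : ℂ :=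
  ∑ᶠ c ∈ {c : LatQuot M L | c ≠ 0}, bracket L f (σ c : v.CInf)

end Basic

end DrinfeldEisenstein

end

open DrinfeldEisenstein

/-! Write `S(s)` for the sum of `|λ|^(-rs)` over nonzero `λ ∈ Λ`. Scaling multiplies the same sum
over `(1/a)Λ` by `|a|^(rs)`. Split `(1/a)Λ` into classes of `Λ`: since `|λ - w| = |λ|` once `|λ| >
|w|`, the sum over the class of `w` differs from `S` by finitely many terms, namely the bracket of
`w`. There are `|a|^r` classes, so `(|a|^(rs) - |a|^r) S(s)` is the coset sum for `Re s > 1`. The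
coset sum is a finite combination of exponentials in `s`, hence entire, and this equation gives the
continuation and (1). The pair `aΛ ⊆ Λ` gives in the same way `(1 - |a|^(r(1-s))) S(s)`, whose
factor does not vanish at `0`; differentiating the exponentials term by term gives (2). The analytic
core is `tsum_eq_cosetSum_add` and `IsEisenstein.eq_quotientForm`.

The arithmetic input is `[Λ : aΛ] = |a|^r`, together with finiteness of `Λ` in balls. A nonconstant
`a ∈ A` has a pole, which can only be `∞`, so `|a| > 1`. For a large box `B` in `k^r` one has `Y + B
= k^r` with `Y ∩ B` finite. Multiplication by `a` preserves both the equality and the size of the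
intersection, so `[Y : aY] = [aB : B]`, and the latter is elementary (`relIndex_smul_eq`). The same
index bounds the number of lattice points in growing balls, which gives absolute convergence. -/

namespace DrinfeldEisenstein

open scoped WithZero NNReal IntermediateField Topology
open WithZero (exp)

/-! ### Existence of a place at which a given nonconstant function has a pole. -/

section FunctionField

variable {F k : Type*} [Field F] [Field k] [Algebra F k]

/-- In transcendence degree one `x` alone is a transcendence basis, so `k` is algebraic and finitely
generated over `F(x)`. -/
theorem finiteDimensional_adjoin_of_transcendental (hfg : (⊤ : IntermediateField F k).FG)
    (htr : Algebra.trdeg F k = 1) {x : k} (hx : Transcendental F x) :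
    FiniteDimensional F⟮x⟯ k := by
  have hb : IsTranscendenceBasis F (fun _ : Unit => x) :=
    (algebraicIndependent_unique_type_iff.2 hx).isTranscendenceBasis_of_lift_trdeg_le_of_finite
      (by simp [htr])
  have := hb.isAlgebraic_field
  rw [Set.range_const] at this
  obtain ⟨S, hS⟩ := hfg
  have h1 : FiniteDimensional F⟮x⟯ (IntermediateField.adjoin F⟮x⟯ (S : Set k)) :=
    IntermediateField.finiteDimensional_adjoin fun y _ =>
      (Algebra.IsAlgebraic.isAlgebraic y).isIntegral
  have h2 : IntermediateField.adjoin F⟮x⟯ (S : Set k) = ⊤ := by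
    rw [eq_top_iff]
    intro y _
    have hy : y ∈ IntermediateField.adjoin F (S : Set k) := by rw [hS]; trivial
    have hle : IntermediateField.adjoin F (S : Set k) ≤
        (IntermediateField.adjoin F⟮x⟯ (S : Set k)).restrictScalars F :=
      IntermediateField.adjoin_le_iff.2 (IntermediateField.subset_adjoin _ _)
    exact hle hy
  rw [h2] at h1
  exact (IntermediateField.topEquiv (F := F⟮x⟯) (E := k)).toLinearEquiv.finiteDimensional

variable {Γ : Type*} [LinearOrderedCommGroupWithZero Γ]

/-- By the ultrametric inequality a largest term attained only once could not be cancelled. -/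
theorem exists_ne_val_eq_of_sum_eq_zero {R ι : Type*} [Ring R] (w : Valuation R Γ) {s : Finset ι}
    {f : ι → R} (h0 : ∑ i ∈ s, f i = 0) (hne : ∃ i ∈ s, w (f i) ≠ 0) :
    ∃ i ∈ s, ∃ j ∈ s, i ≠ j ∧ w (f i) = w (f j) ∧ w (f i) ≠ 0 := by
  classical
  obtain ⟨i₀, hi₀, h⟩ := hne
  obtain ⟨i, hi, hmax⟩ := s.exists_max_image (fun i => w (f i)) ⟨i₀, hi₀⟩
  have hi0 : w (f i) ≠ 0 := fun h' => h (le_zero_iff.1 (h' ▸ hmax i₀ hi₀))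
  by_contra! hc
  refine hi0 ?_
  rw [← w.map_sum_eq_of_lt hi fun j hj => ?_, h0, map_zero]
  rw [Finset.mem_sdiff, Finset.mem_singleton] at hj
  exact lt_of_le_of_ne (hmax j hj.1) fun he => hi0 (hc i hi j hj.1 (Ne.symm hj.2) he.symm)

/-- As `w x > 1`, the leading term of a polynomial in `x` dominates, so its value depends only on
the degree. -/
theorem exists_val_eq_zpow_of_mem_adjoin (w : Valuation k Γ) [w.IsTrivialOn F] {x : k}
    (hx : 1 < w x) {y : k} (hy : y ∈ F⟮x⟯) (hy0 : y ≠ 0) : ∃ m : ℤ, w y = w x ^ m := by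
  obtain ⟨p, q, rfl⟩ := IntermediateField.mem_adjoin_simple_iff F y |>.1 hy
  have hp : p ≠ 0 := by rintro rfl; simp at hy0
  have hq : q ≠ 0 := by rintro rfl; simp at hy0
  refine ⟨p.natDegree - q.natDegree, ?_⟩
  have hx0 : w x ≠ 0 := (zero_lt_one.trans hx).ne'
  rw [map_div₀,
    Polynomial.valuation_aeval_eq_valuation_X_pow_natDegree_of_one_lt_valuation_X x hx hp,
    Polynomial.valuation_aeval_eq_valuation_X_pow_natDegree_of_one_lt_valuation_X x hx hq,
    zpow_sub₀ hx0, zpow_natCast, zpow_natCast]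

/-- Two terms of the minimal polynomial relation of `y` over `F(x)` have equal value, which makes
some power of `w y` a power of `w x`. The factorial makes the exponent independent of `y`. -/
theorem exists_val_pow_eq_zpow (w : Valuation k Γ) [w.IsTrivialOn F] {x : k}
    (hx : 1 < w x) [FiniteDimensional F⟮x⟯ k] {y : k} (hy0 : y ≠ 0) :
    ∃ m : ℤ, w y ^ (Module.finrank F⟮x⟯ k).factorial = w x ^ m := by
  have hint : IsIntegral F⟮x⟯ y := IsIntegral.of_finite _ y
  have hsum := minpoly.aeval F⟮x⟯ y
  rw [Polynomial.aeval_eq_sum_range] at hsum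
  have hwy : w y ≠ 0 := by simpa using hy0
  have hx0 : w x ≠ 0 := (zero_lt_one.trans hx).ne'
  obtain ⟨i, hi, j, hj, hij, he, hne⟩ := exists_ne_val_eq_of_sum_eq_zero w hsum
    ⟨_, Finset.self_mem_range_succ _, by
      rw [(minpoly.monic hint).coeff_natDegree, one_smul, map_pow]; exact pow_ne_zero _ hwy⟩
  wlog hlt : i < j generalizing i j
  · exact this j hj i hi hij.symm he.symm (he ▸ hne) (by omega)
  have hdeg := minpoly.natDegree_le (A := F⟮x⟯) y
  rw [Finset.mem_range] at hj
  simp only [Algebra.smul_def, map_mul, map_pow] at he hne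
  have hci : ((minpoly F⟮x⟯ y).coeff i : k) ≠ 0 := fun h => by
    rw [IntermediateField.algebraMap_apply, h] at hne; simp at hne
  have hcj : ((minpoly F⟮x⟯ y).coeff j : k) ≠ 0 := fun h => by
    rw [he, IntermediateField.algebraMap_apply, h] at hne; simp at hne
  obtain ⟨m, hm⟩ := exists_val_eq_zpow_of_mem_adjoin w hx (SetLike.coe_mem _) hci
  obtain ⟨n, hn⟩ := exists_val_eq_zpow_of_mem_adjoin w hx (SetLike.coe_mem _) hcj
  rw [IntermediateField.algebraMap_apply, IntermediateField.algebraMap_apply, hm, hn] at he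
  have h3 : w y ^ (j - i) = w x ^ (m - n) := by
    rw [zpow_sub₀ hx0, eq_div_iff (zpow_ne_zero _ hx0)]
    refine mul_left_cancel₀ (pow_ne_zero i hwy) ?_
    rw [← mul_assoc, ← pow_add, Nat.add_sub_cancel' hlt.le, mul_comm, ← he, mul_comm]
  obtain ⟨c, hc⟩ := Nat.dvd_factorial (m := j - i) (n := Module.finrank F⟮x⟯ k)
    (by omega) (by omega)
  refine ⟨(m - n) * c, ?_⟩
  rw [hc, pow_mul, h3, zpow_mul, zpow_natCast]

/-- The exponent `m y` is a homomorphism to `ℤ`, injective because an ordered group has no torsion.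
-/
theorem isCyclic_units_of_pow_eq_zpow {g : Γˣ} (hg : 1 < g) {N : ℕ} (hN : N ≠ 0)
    (h : ∀ y : Γˣ, ∃ m : ℤ, y ^ N = g ^ m) : IsCyclic Γˣ := by
  choose m hm using h
  have hinj : Function.Injective fun n : ℤ => g ^ n := (zpow_right_strictMono hg).injective
  let φ : Γˣ →* Multiplicative ℤ :=
    { toFun := fun y => Multiplicative.ofAdd (m y)
      map_one' := by
        have : m 1 = 0 := hinj (by simp only [← hm, one_pow, zpow_zero])
        rw [this]; rfl
      map_mul' := fun y y' => by
        have : m (y * y') = m y + m y' := hinj (by simp only [← hm, mul_pow, zpow_add])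
        rw [this]; rfl }
  refine isCyclic_of_injective φ fun y y' hyy => ?_
  have h1 : m y = m y' := hyy
  have h2 : y ^ N = y' ^ N := by rw [hm, hm, h1]
  exact pow_left_injective hN h2

theorem exists_place_of_isCyclic_units {w : Valuation k Γ} (hw : Function.Surjective w)
    {x : k} (hx : 1 < w x) [IsCyclic Γˣ] : ∃ u : Place k, 1 < u.val x := by
  have : Nontrivial Γˣ := ⟨Units.mk0 (w x) (zero_lt_one.trans hx).ne', 1, fun h => hx.ne' (by
    simpa using congrArg Units.val h)⟩
  obtain ⟨e⟩ := LinearOrderedCommGroup.isCyclic_iff_nonempty_equiv_int.1 ‹IsCyclic Γˣ›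
  let e' : Γ ≃*o ℤᵐ⁰ := (OrderMonoidIso.withZeroUnits (α := Γ)).symm.trans e.withZero
  refine ⟨⟨w.map (MonoidWithZeroHom.ofClass e') e'.strictMono.monotone,
    e'.surjective.comp hw⟩, ?_⟩
  have := e'.strictMono hx
  rw [map_one] at this
  exact this

/-- A valuation ring containing `F[1/x]`, with `1/x` a nonunit, gives a valuation with a pole at
`x`. Its value group is cyclic because `k` is finite over `F(x)`, so it can be normalized to a
place. -/
theorem exists_place_one_lt [Finite F] (hfg : (⊤ : IntermediateField F k).FG)
    (htr : Algebra.trdeg F k = 1) {x : k} (hx : Transcendental F x) :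
    ∃ u : Place k, 1 < u.val x := by
  have hx0 : x ≠ 0 := by rintro rfl; exact hx (isAlgebraic_zero)
  let S : Subring k := (Algebra.adjoin F {x⁻¹}).toSubring
  let t : S := ⟨x⁻¹, Algebra.self_mem_adjoin_singleton F _⟩
  have hI : Ideal.span {t} ≠ ⊤ := by
    rw [Ne, Ideal.eq_top_iff_one, Ideal.mem_span_singleton]
    rintro ⟨⟨c, hc⟩, h⟩
    have hc' : 1 = x⁻¹ * c := congrArg Subtype.val h
    have hcx : c = x := by field_simp at hc'; exact hc'.symm
    have hcS : c ∈ Algebra.adjoin F {x⁻¹} := hc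
    rw [hcx, Algebra.adjoin_singleton_eq_range_aeval] at hcS
    obtain ⟨p, hp⟩ := hcS
    -- If `1/x` were invertible in `F[1/x]`, then `x = p(1/x)`, and `X * p - 1` would be a nonzero
    -- polynomial vanishing at `1/x`.
    refine hx (IsAlgebraic.inv_iff.1 ⟨Polynomial.X * p - 1, fun h => ?_, ?_⟩)
    · simpa using congrArg (Polynomial.eval 0) h
    · have hp' : Polynomial.aeval x⁻¹ p = x := hp
      simp [hp', hx0]
  obtain ⟨B, hB, hB'⟩ := Ideal.image_subset_nonunits_valuationSubring _ hI
  have := finiteDimensional_adjoin_of_transcendental hfg htr hx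
  have hx1 : 1 < B.valuation x := by
    have : x⁻¹ ∈ B.nonunits := hB' ⟨t, Ideal.mem_span_singleton_self t, rfl⟩
    rw [ValuationSubring.mem_nonunits_iff, map_inv₀] at this
    exact (inv_lt_one₀ (by simpa [zero_lt_iff] using hx0)).1 this
  have hx1' : 1 < Units.mk0 (B.valuation x) (zero_lt_one.trans hx1).ne' := by
    rwa [← Units.val_lt_val]
  have : IsCyclic (B.ValueGroup)ˣ := by
    refine isCyclic_units_of_pow_eq_zpow hx1' (N := (Module.finrank F⟮x⟯ k).factorial)
      (Nat.factorial_ne_zero _) fun y => ?_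
    obtain ⟨z, hz⟩ := B.valuation_surjective y
    obtain ⟨m, hm⟩ := exists_val_pow_eq_zpow (F := F) B.valuation hx1 (y := z) (by
      rintro rfl; rw [map_zero] at hz; exact y.ne_zero hz.symm)
    exact ⟨m, Units.ext (by simpa [hz] using hm)⟩
  exact exists_place_of_isCyclic_units B.valuation_surjective hx1

end FunctionField

/-! ### The ring `A`: poles, integrality, balls of `k`, the residue field, and `A + ball = k`. -/

section RegularFunctions

variable {F k : Type*} [Field F] [Field k] [Algebra F k]

theorem transcendental_of_notMem_range (hconst : algebraicClosure F k = ⊥) {x : k}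
    (hx : x ∉ Set.range (algebraMap F k)) : Transcendental F x := fun h =>
  hx (IntermediateField.mem_bot.1 (hconst ▸ mem_algebraicClosure_iff.2 h))

namespace Place

theorem mem_ringAway {v : Place k} {x : k} :
    x ∈ v.ringAway ↔ ∀ w : Place k, w ≠ v → w.val x ≤ 1 := by
  simp only [ringAway, Subring.mem_iInf, Subtype.forall]
  rfl

theorem one_lt_val_of_mem_ringAway [Finite F] (hfg : (⊤ : IntermediateField F k).FG)
    (htr : Algebra.trdeg F k = 1) (hconst : algebraicClosure F k = ⊥) {v : Place k} {a : k}
    (ha : a ∈ v.ringAway) (ha' : a ∉ Set.range (algebraMap F k)) : 1 < v.val a := by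
  obtain ⟨u, hu⟩ := exists_place_one_lt hfg htr (transcendental_of_notMem_range hconst ha')
  by_cases h : u = v
  · rwa [← h]
  · exact absurd (mem_ringAway.1 ha u h) hu.not_ge

/-- Valuation rings are integrally closed, and those of places other than `v` contain `F[a]`, since
valuations are trivial on a finite field. -/
theorem mem_ringAway_of_isIntegral [Finite F] {v : Place k} {a : k} (ha : a ∈ v.ringAway) {y : k}
    (hy : IsIntegral (Algebra.adjoin F {a}) y) : y ∈ v.ringAway := by
  refine mem_ringAway.2 fun w hw => ?_
  have hle : (Algebra.adjoin F {a}).toSubring ≤ w.val.valuationSubring.toSubring := by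
    intro z hz
    refine Algebra.adjoin_induction (p := fun z _ => z ∈ w.val.valuationSubring) ?_ ?_
      (fun _ _ _ _ => add_mem) (fun _ _ _ _ => mul_mem) hz
    · rintro z rfl
      exact mem_ringAway.1 ha w hw
    · exact fun c => FiniteField.valuation_algebraMap_le_one w.val c
  have hy' : IsIntegral w.val.valuationSubring y := by
    obtain ⟨p, hp, hpy⟩ := hy
    refine ⟨p.map (Subring.inclusion hle), hp.map _, ?_⟩
    rw [Polynomial.eval₂_map]
    exact hpy
  obtain ⟨z, rfl⟩ := IsIntegrallyClosed.isIntegral_iff.1 hy'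
  exact z.2

theorem exists_mul_mem_ringAway [Finite F] (htr : Algebra.trdeg F k = 1) {v : Place k} {a : k}
    (ha : a ∈ v.ringAway) (hta : Transcendental F a) (y : k) :
    ∃ d ∈ Algebra.adjoin F {a}, d ≠ 0 ∧ d * y ∈ v.ringAway := by
  have hb : IsTranscendenceBasis F (fun _ : Unit => a) :=
    (algebraicIndependent_unique_type_iff.2 hta).isTranscendenceBasis_of_lift_trdeg_le_of_finite
      (by simp [htr])
  have := hb.isAlgebraic
  rw [Set.range_const] at this
  obtain ⟨d, hd, hdy⟩ :=
    (Algebra.IsAlgebraic.isAlgebraic (R := Algebra.adjoin F {a}) y).exists_integral_multiple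
  exact ⟨d, d.2, by simpa using hd, mem_ringAway_of_isIntegral ha hdy⟩

theorem adjoin_le_ringAway [Finite F] {v : Place k} {a : k} (ha : a ∈ v.ringAway) {d : k}
    (hd : d ∈ Algebra.adjoin F {a}) : d ∈ v.ringAway :=
  mem_ringAway_of_isIntegral ha (isIntegral_algebraMap (x := (⟨d, hd⟩ : Algebra.adjoin F {a})))

theorem isFractionRing_ringAway {v : Place k}
    (h : ∀ y : k, ∃ d ∈ v.ringAway, d ≠ 0 ∧ d * y ∈ v.ringAway) :
    IsFractionRing v.ringAway k := by
  refine IsFractionRing.of_field _ _ fun y => ?_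
  obtain ⟨d, hd, hd0, hdy⟩ := h y
  exact ⟨⟨d * y, hdy⟩, ⟨d, hd⟩, by
    change y = (d * y) / d
    field_simp⟩

/-- The elements of `k` with `|x|_v ≤ exp m`. -/
def ball (v : Place k) (m : ℤ) : AddSubgroup k where
  carrier := {x | v.val x ≤ exp m}
  zero_mem' := by simp
  add_mem' hx hy := v.val.map_add_le hx hy
  neg_mem' hx := by simpa using hx

theorem mem_ball {v : Place k} {m : ℤ} {x : k} : x ∈ v.ball m ↔ v.val x ≤ exp m := Iff.rfl

theorem ball_mono (v : Place k) {m n : ℤ} (h : m ≤ n) : v.ball m ≤ v.ball n := fun _ hx =>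
  (mem_ball.1 hx).trans (WithZero.exp_le_exp.2 h)

theorem exists_mem_ball (v : Place k) (x : k) : ∃ m, x ∈ v.ball m := by
  by_cases hx : x = 0
  · exact ⟨0, hx ▸ zero_mem _⟩
  · exact ⟨WithZero.log (v.val x), by rw [mem_ball, WithZero.exp_log (by simpa using hx)]⟩

theorem mul_mem_ball_add {v : Place k} {m n : ℤ} {x y : k} (hx : x ∈ v.ball m) (hy : y ∈ v.ball n) :
    x * y ∈ v.ball (m + n) := by
  rw [mem_ball, map_mul, WithZero.exp_add]
  exact mul_le_mul' hx hy

theorem map_mulLeft_ball {v : Place k} {c : k} {n : ℤ} (hc : v.val c = exp n) (m : ℤ) :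
    (v.ball m).map (AddMonoidHom.mulLeft c) = v.ball (m + n) := by
  have hc0 : c ≠ 0 := by rintro rfl; exact WithZero.exp_ne_zero (v.val.map_zero ▸ hc).symm
  have hci : v.val c⁻¹ = exp (-n) := by rw [map_inv₀, hc, WithZero.exp_neg]
  ext x
  simp only [AddSubgroup.mem_map, AddMonoidHom.coe_mulLeft]
  constructor
  · rintro ⟨y, hy, rfl⟩
    rw [add_comm]
    exact mul_mem_ball_add (mem_ball.2 hc.le) hy
  · refine fun hx => ⟨c⁻¹ * x, ?_, mul_inv_cancel_left₀ hc0 x⟩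
    have := mul_mem_ball_add (mem_ball.2 hci.le) hx
    rwa [show -n + (m + n) = m by ring] at this

/-- Scaling by an element of value `exp (m + 1)` reduces to the maximal ideal inside the valuation
ring; by discreteness `< 1` means `≤ exp (-1)`. -/
theorem relIndex_ball_succ (v : Place k) (m : ℤ) : (v.ball m).relIndex (v.ball (m + 1)) = v.q := by
  obtain ⟨c, hc⟩ := v.surj (exp (m + 1))
  have hc0 : c ≠ 0 := by rintro rfl; exact WithZero.exp_ne_zero (v.val.map_zero ▸ hc).symm
  have h1 := map_mulLeft_ball hc (-1)
  have h0 := map_mulLeft_ball hc 0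
  rw [show -1 + (m + 1) = m by ring] at h1
  rw [zero_add] at h0
  rw [← h1, ← h0, AddSubgroup.relIndex_map_map_of_injective _ _ (mul_right_injective₀ hc0)]
  rw [AddSubgroup.relIndex, AddSubgroup.index, q]
  let e : v.ball 0 ≃+ v.val.valuationSubring :=
    { toFun := fun x => ⟨x, mem_ball.1 x.2⟩
      invFun := fun x => ⟨x, mem_ball.2 x.2⟩
      left_inv := fun _ => rfl
      right_inv := fun _ => rfl
      map_add' := fun _ _ => rfl }
  refine Nat.card_congr (QuotientAddGroup.congr _
    (IsLocalRing.maximalIdeal v.val.valuationSubring).toAddSubgroup e ?_).toEquiv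
  ext x
  refine (AddSubgroup.mem_map_equiv (f := e)).trans ?_
  change v.val (x : k) ≤ exp (-1) ↔ x ∈ IsLocalRing.maximalIdeal v.val.valuationSubring
  rw [Valuation.mem_maximalIdeal_iff]
  by_cases hx : v.val (x : k) = 0
  · simp [hx]
  · rw [← WithZero.exp_log hx, ← WithZero.exp_zero, WithZero.exp_le_exp, WithZero.exp_lt_exp]
    omega

theorem relIndex_ball_add (v : Place k) (m : ℤ) (n : ℕ) :
    (v.ball m).relIndex (v.ball (m + n)) = v.q ^ n := by
  induction n with
  | zero => simp
  | succ n ih =>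
    rw [← AddSubgroup.relIndex_mul_relIndex _ _ _ (v.ball_mono (m := m) (n := m + n) (by omega))
      (v.ball_mono (by push_cast; omega)), ih, pow_succ, Nat.cast_succ, ← add_assoc,
      relIndex_ball_succ]

/-- Division with remainder: the quotient is the polynomial part, and the remainder over `q` has
negative degree. -/
theorem exists_val_sub_aeval_lt_one (w : Valuation k ℤᵐ⁰) [w.IsTrivialOn F] {a : k}
    (ha : 1 < w a) {g : k} (hg : g ∈ F⟮a⟯) :
    ∃ P : Polynomial F, w (g - Polynomial.aeval a P) < 1 := by
  obtain ⟨p, q, rfl⟩ := IntermediateField.mem_adjoin_simple_iff F g |>.1 hg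
  by_cases hq : q = 0
  · exact ⟨0, by simp [hq]⟩
  refine ⟨p / q, ?_⟩
  have hwq := Polynomial.valuation_aeval_eq_valuation_X_pow_natDegree_of_one_lt_valuation_X a ha hq
  have hwq0 : 0 < w (Polynomial.aeval a q) := by
    rw [hwq]; exact pow_pos (zero_lt_one.trans ha) _
  have hq0 : Polynomial.aeval a q ≠ 0 := fun h => by simp [h] at hwq0
  have hsub : Polynomial.aeval a p / Polynomial.aeval a q - Polynomial.aeval a (p / q) =
      Polynomial.aeval a (p % q) / Polynomial.aeval a q := by
    nth_rw 1 [← EuclideanDomain.div_add_mod p q]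
    rw [map_add, map_mul]
    field_simp
    ring
  rw [hsub, map_div₀, div_lt_one₀ hwq0]
  by_cases hr : p % q = 0
  · rwa [hr, map_zero, map_zero]
  · rw [hwq, Polynomial.valuation_aeval_eq_valuation_X_pow_natDegree_of_one_lt_valuation_X a ha hr]
    exact pow_lt_pow_right₀ ha (Polynomial.natDegree_lt_natDegree hr (Polynomial.degree_mod_lt p hq))

/-- The polynomial part of an integral `g` must be constant: the residue field of `F(a)` at `w` is
`F`. -/
theorem exists_val_sub_algebraMap_lt_one (w : Valuation k ℤᵐ⁰) [w.IsTrivialOn F] {a : k}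
    (ha : 1 < w a) {g : k} (hg : g ∈ F⟮a⟯) (hg1 : w g ≤ 1) :
    ∃ c : F, w (g - algebraMap F k c) < 1 := by
  obtain ⟨P, hP⟩ := exists_val_sub_aeval_lt_one w ha hg
  suffices P.natDegree = 0 by
    rw [Polynomial.eq_C_of_natDegree_eq_zero this, Polynomial.aeval_C] at hP
    exact ⟨_, hP⟩
  by_contra hdeg
  have hP0 : P ≠ 0 := by rintro rfl; simp at hdeg
  have h1 : w (Polynomial.aeval a P) ≤ 1 := by
    rw [← sub_sub_cancel g (Polynomial.aeval a P)]
    exact w.map_sub_le hg1 hP.le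
  rw [Polynomial.valuation_aeval_eq_valuation_X_pow_natDegree_of_one_lt_valuation_X a ha hP0] at h1
  exact h1.not_gt (one_lt_pow₀ ha hdeg)

/-- The residue degree over `F` is at most `[k : F(a)]`: an `F(a)`-relation between lifts of
residues reduces to a nontrivial `F`-relation between the residues. -/
theorem finite_residueField [Finite F] (v : Place k) {a : k} (ha : 1 < v.val a)
    [FiniteDimensional F⟮a⟯ k] : Finite (IsLocalRing.ResidueField v.val.valuationSubring) := by
  let O := v.val.valuationSubring
  let f : F →+* O := (algebraMap F k).codRestrict O
    fun c => FiniteField.valuation_algebraMap_le_one v.val c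
  let : Algebra F (IsLocalRing.ResidueField O) := ((IsLocalRing.residue O).comp f).toAlgebra
  suffices Module.Finite F (IsLocalRing.ResidueField O) from Module.finite_of_finite F
  by_contra hinf
  rw [← Module.rank_lt_aleph0_iff, not_lt] at hinf
  obtain ⟨s, hs, hli⟩ := le_rank_iff_exists_linearIndependent_finset.1
    ((Cardinal.natCast_lt_aleph0 (n := Module.finrank F⟮a⟯ k + 1)).le.trans hinf)
  choose u hu using IsLocalRing.residue_surjective (R := O)
  have hdep : ¬ LinearIndependent F⟮a⟯ fun i : s => (u i : k) := fun h => by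
    have := h.fintype_card_le_finrank
    rw [Fintype.card_coe, hs] at this
    omega
  obtain ⟨g, hg, i₀, hgi₀⟩ := Fintype.not_linearIndependent_iff.1 hdep
  -- Dividing by the coefficient of largest value makes all coefficients integral and the `i`-th
  -- equal to `1`, so the reduced relation stays nontrivial.
  obtain ⟨i, -, hmax⟩ := Finset.univ.exists_max_image (fun i => v.val (g i : k))
    ⟨i₀, Finset.mem_univ _⟩
  have hgi : (g i : k) ≠ 0 := fun h => hgi₀ (by
    have := hmax i₀ (Finset.mem_univ _)
    rw [h, map_zero, le_zero_iff, map_eq_zero] at this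
    exact_mod_cast this)
  have hle : ∀ j, v.val ((g j / g i : F⟮a⟯) : k) ≤ 1 := fun j => by
    have h0 : 0 < v.val (g i : k) := by simpa [zero_lt_iff] using hgi
    rw [IntermediateField.coe_div, map_div₀]
    exact (div_le_one₀ h0).2 (hmax j (Finset.mem_univ _))
  choose c hc using fun j => exists_val_sub_algebraMap_lt_one v.val ha
    (SetLike.coe_mem (g j / g i)) (hle j)
  have hci : c i ≠ 0 := fun h => by
    have := hc i
    rw [h, IntermediateField.coe_div, div_self hgi] at this
    simp at this
  refine hci (Fintype.linearIndependent_iff.1 hli c ?_ i)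
  have hsum : ∑ j, ((g j / g i : F⟮a⟯) : k) * u j = 0 := by
    have := congrArg (fun x => x / (g i : k)) hg
    simp only [zero_div, Finset.sum_div, Algebra.smul_def, IntermediateField.algebraMap_apply] at this
    rw [← this]
    refine Finset.sum_congr rfl fun j _ => ?_
    rw [IntermediateField.coe_div]
    ring
  have hlt : v.val (∑ j, algebraMap F k (c j) * u j) < 1 := by
    rw [← Valuation.map_neg, ← zero_sub, ← hsum, ← Finset.sum_sub_distrib]
    refine v.val.map_sum_lt one_ne_zero fun j _ => ?_
    rw [← sub_mul, map_mul]
    exact mul_lt_one_of_lt_of_le (hc j) (u j).2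
  have : (∑ j, f (c j) * u j : O) ∈ IsLocalRing.maximalIdeal O := by
    rw [Valuation.mem_maximalIdeal_iff]
    convert hlt
    push_cast
    rfl
  rw [← IsLocalRing.residue_eq_zero_iff, map_sum] at this
  rw [← this]
  refine Finset.sum_congr rfl fun j _ => ?_
  rw [map_mul, hu, Algebra.smul_def]
  rfl

theorem two_le_q (v : Place k) [Finite (IsLocalRing.ResidueField v.val.valuationSubring)] :
    2 ≤ v.q := Finite.one_lt_card

theorem base_eq_q (v : Place k) [Finite (IsLocalRing.ResidueField v.val.valuationSubring)] :
    v.base = v.q := max_eq_right (by exact_mod_cast v.two_le_q)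

theorem abs_eq_zpow (v : Place k) {x : k} {n : ℤ} (hx : v.val x = exp n) :
    v.abs x = (v.base : ℝ) ^ n := by
  change ((WithZeroMulInt.toNNReal v.one_lt_base.ne_zero (v.val x) : ℝ≥0) : ℝ) = _
  rw [hx, WithZeroMulInt.toNNReal_neg_apply _ WithZero.exp_ne_zero]
  simp [WithZero.exp]

theorem abs_le_zpow_iff (v : Place k) {x : k} {n : ℤ} :
    v.abs x ≤ (v.base : ℝ) ^ n ↔ x ∈ v.ball n := by
  have hb : (1 : ℝ) < v.base := by exact_mod_cast v.one_lt_base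
  by_cases hx : x = 0
  · subst hx
    simp [zpow_nonneg]
  · have hx' := WithZero.exp_log (show v.val x ≠ 0 by simpa using hx)
    rw [v.abs_eq_zpow hx'.symm, mem_ball, zpow_le_zpow_iff_right₀ hb]
    nth_rw 2 [← hx']
    rw [WithZero.exp_le_exp]

/-- Scale an `F(a)`-basis of `k` into `A`. Each coordinate of `x` is a polynomial in `a`, which
contributes to `A`, plus an element of value below `1`, which contributes a bounded error. -/
theorem exists_sup_ball_eq_top [Finite F] {v : Place k} {a : k} (ha : a ∈ v.ringAway)
    (ha1 : 1 < v.val a) [FiniteDimensional F⟮a⟯ k]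
    (hfrac : ∀ y : k, ∃ d ∈ Algebra.adjoin F {a}, d ≠ 0 ∧ d * y ∈ v.ringAway) :
    ∃ m, v.ringAway.toAddSubgroup ⊔ v.ball m = ⊤ := by
  let b := Module.finBasis F⟮a⟯ k
  choose d hd hd0 hdb using fun i => hfrac (b i)
  choose m hm using fun i => v.exists_mem_ball (d i * b i)
  obtain ⟨M, hM⟩ := Finset.exists_le (Finset.univ.image m)
  refine ⟨M, eq_top_iff.2 fun x _ => ?_⟩
  have hmem : ∀ i, (b.repr x i : k) / d i ∈ F⟮a⟯ := fun i =>
    div_mem (SetLike.coe_mem _) (IntermediateField.algebra_adjoin_le_adjoin F _ (hd i))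
  choose P hP using fun i => exists_val_sub_aeval_lt_one v.val ha1 (hmem i)
  have hx : x = ∑ i, Polynomial.aeval a (P i) * (d i * b i) +
      ∑ i, ((b.repr x i : k) / d i - Polynomial.aeval a (P i)) * (d i * b i) := by
    nth_rw 1 [← b.sum_repr x]
    rw [← Finset.sum_add_distrib]
    refine Finset.sum_congr rfl fun i _ => ?_
    rw [Algebra.smul_def, IntermediateField.algebraMap_apply]
    have := hd0 i
    field_simp
    ring
  rw [hx]
  refine AddSubgroup.add_mem_sup (sum_mem fun i _ => ?_) (sum_mem fun i _ => ?_)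
  · exact v.ringAway.mul_mem (adjoin_le_ringAway ha (F := F)
      (Algebra.adjoin_singleton_eq_range_aeval F a ▸ ⟨P i, rfl⟩)) (hdb i)
  · refine v.ball_mono (hM (m i) (Finset.mem_image_of_mem _ (Finset.mem_univ _))) ?_
    rw [← zero_add (m i)]
    refine mul_mem_ball_add ?_ (hm i)
    rw [mem_ball, WithZero.exp_zero]
    exact (hP i).le

/-- Nonconstant elements of `A` have value above `1`, so the unit ball meets `A` in constants only;
each larger ball multiplies the count by at most `q`. -/
theorem finite_inf_ball [Finite F] (hfg : (⊤ : IntermediateField F k).FG)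
    (htr : Algebra.trdeg F k = 1) (hconst : algebraicClosure F k = ⊥) (v : Place k)
    [Finite (IsLocalRing.ResidueField v.val.valuationSubring)] (m : ℤ) :
    Finite (v.ringAway.toAddSubgroup ⊓ v.ball m : AddSubgroup k) := by
  have key : ∀ n : ℕ, Finite (v.ball n ⊓ v.ringAway.toAddSubgroup : AddSubgroup k) := by
    intro n
    induction n with
    | zero =>
      refine Set.Finite.subset (Set.finite_range (algebraMap F k)) fun x hx => ?_
      by_contra hxF
      have h1 := one_lt_val_of_mem_ringAway hfg htr hconst hx.2 hxF
      have h2 : v.val x ≤ 1 := by simpa [mem_ball] using hx.1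
      exact h2.not_gt h1
    | succ n ih =>
      refine Nat.finite_of_card_ne_zero ?_
      rw [← AddSubgroup.relIndex_bot_left, ← AddSubgroup.relIndex_mul_relIndex _ _ _ bot_le
        (inf_le_inf_right _ (v.ball_mono (show (n : ℤ) ≤ (n + 1 : ℕ) by omega))),
        AddSubgroup.relIndex_bot_left]
      refine mul_ne_zero Nat.card_pos.ne' (AddSubgroup.relIndex_inter_ne_zero ?_ _)
      rw [Nat.cast_succ, relIndex_ball_succ]
      exact (zero_lt_two.trans_le v.two_le_q).ne'
  have := key m.toNat
  exact Set.Finite.subset this fun x hx => ⟨v.ball_mono (Int.self_le_toNat m) hx.2, hx.1⟩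

end Place

end RegularFunctions

/-! ### Comparing indices of subgroups through their intersections. -/

section Index

/-- By the modular law `K = (K ⊓ M) ⊔ H`, so `K / H` is isomorphic to `(K ⊓ M) / (H ⊓ M)`. -/
theorem card_inf_mul_relIndex {G : Type*} [AddCommGroup G] {H K M : AddSubgroup G} (hHK : H ≤ K)
    (hM : H ⊔ M = ⊤) :
    Nat.card (H ⊓ M : AddSubgroup G) * H.relIndex K = Nat.card (K ⊓ M : AddSubgroup G) := by
  have h1 : K ⊓ M ⊔ H = K := by
    refine le_antisymm (sup_le inf_le_left hHK) fun x hx => ?_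
    obtain ⟨y, hy, b, hb, rfl⟩ := AddSubgroup.mem_sup.1 (hM ▸ AddSubgroup.mem_top x : x ∈ H ⊔ M)
    rw [add_comm]
    exact AddSubgroup.add_mem_sup ⟨(add_mem_cancel_left (hHK hy)).1 hx, hb⟩ hy
  have h2 : H ⊓ (K ⊓ M) = H ⊓ M := by rw [← inf_assoc, inf_eq_left.2 hHK]
  have h3 : H.relIndex K = H.relIndex (K ⊓ M ⊔ H) := by rw [h1]
  rw [h3, AddSubgroup.relIndex_sup_right, ← AddSubgroup.inf_relIndex_right, h2,
    ← AddSubgroup.relIndex_bot_left, ← AddSubgroup.relIndex_bot_left,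
    AddSubgroup.relIndex_mul_relIndex _ _ _ bot_le (inf_le_inf_right _ hHK)]

/-- Both indices equal the ratio of `card (Y ⊓ B')` to the common cardinality in `hc`. This plays
the role of an Euler characteristic count. -/
theorem relIndex_eq_relIndex_of_sup_eq_top {G : Type*} [AddCommGroup G] {Y Y' B B' : AddSubgroup G}
    (hY : Y' ≤ Y) (hB : B ≤ B') (h1 : Y ⊔ B = ⊤) (h2 : Y' ⊔ B' = ⊤)
    [Finite (Y ⊓ B : AddSubgroup G)]
    (hc : Nat.card (Y' ⊓ B' : AddSubgroup G) = Nat.card (Y ⊓ B : AddSubgroup G)) :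
    Y'.relIndex Y = B.relIndex B' := by
  have e1 := card_inf_mul_relIndex hY h2
  have e2 := card_inf_mul_relIndex hB (by rwa [sup_comm] : B ⊔ Y = ⊤)
  rw [inf_comm B Y, inf_comm B' Y, ← e1, hc] at e2
  exact (Nat.eq_of_mul_eq_mul_left Nat.card_pos e2).symm

theorem relIndex_pi_const {G ι : Type*} [AddGroup G] [Fintype ι] {H K : AddSubgroup G}
    (hHK : H ≤ K) :
    (AddSubgroup.pi Set.univ fun _ : ι => H).relIndex (AddSubgroup.pi Set.univ fun _ : ι => K) =
      H.relIndex K ^ Fintype.card ι := by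
  let f : (ι → K) →+ (ι → G) :=
    { toFun := fun x i => x i
      map_zero' := rfl
      map_add' := fun _ _ => rfl }
  have hf : Function.Injective f := fun x y h => funext fun i => Subtype.ext (congrFun h i)
  have hK : AddSubgroup.pi Set.univ (fun _ : ι => K) = (⊤ : AddSubgroup (ι → K)).map f := by
    ext x
    simp only [AddSubgroup.mem_pi, Set.mem_univ, true_implies, AddSubgroup.mem_map,
      AddSubgroup.mem_top, true_and]
    exact ⟨fun h => ⟨fun i => ⟨x i, h i⟩, rfl⟩, fun ⟨y, hy⟩ i => hy ▸ (y i).2⟩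
  have hH : AddSubgroup.pi Set.univ (fun _ : ι => H) =
      (AddSubgroup.pi Set.univ fun _ : ι => H.addSubgroupOf K).map f := by
    ext x
    simp only [AddSubgroup.mem_pi, Set.mem_univ, true_implies, AddSubgroup.mem_map]
    exact ⟨fun h => ⟨fun i => ⟨x i, hHK (h i)⟩, h, rfl⟩, fun ⟨y, hy, e⟩ i => e ▸ hy i⟩
  rw [hK, hH, AddSubgroup.relIndex_map_map_of_injective _ _ hf, AddSubgroup.relIndex_top_right,
    AddSubgroup.index_pi, Finset.prod_const, Finset.card_univ, AddSubgroup.relIndex]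

end Index

/-! ### Projective modules of finite nonzero rank over a domain. -/

section Projective

variable {R M : Type*} [CommRing R] [IsDomain R] [AddCommGroup M] [Module R M]

theorem exists_linearIndependent_torsion_quotient {n : ℕ} (hn : n ≠ 0)
    (hrank : Module.finrank R M = n) :
    ∃ b : Fin n → M, LinearIndependent R b ∧
      ∀ y, ∃ d : R, d ≠ 0 ∧ d • y ∈ Submodule.span R (Set.range b) := by
  have hrk : Module.rank R M = n := by
    rw [← hrank, Module.finrank, Cardinal.cast_toNat_of_lt_aleph0]
    -- `finrank` is `0` for infinite rank, so `hn` rules that case out.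
    by_contra h
    exact hn (hrank ▸ Cardinal.toNat_apply_of_aleph0_le (not_lt.1 h))
  obtain ⟨b, hb⟩ := exists_linearIndependent_of_le_finrank hrank.ge
  refine ⟨b, hb, fun y => ?_⟩
  classical
  have h0 : Module.rank R (M ⧸ Submodule.span R (Set.range b)) = 0 := by
    have := rank_quotient_add_rank_of_isDomain (Submodule.span R (Set.range b))
    rw [hrk, rank_span hb, Cardinal.mk_fintype, Set.card_range_of_injective hb.injective,
      Fintype.card_fin] at this
    exact Cardinal.eq_of_add_eq_add_right (by rw [this, zero_add]) (Cardinal.natCast_lt_aleph0)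
  obtain ⟨d, hd, hdy⟩ := rank_eq_zero_iff.1 h0 (Submodule.Quotient.mk y)
  exact ⟨d, hd, (Submodule.Quotient.mk_eq_zero _).1 hdy⟩

/-- Embed `M` in a free module by a section `s`. A maximal independent family involves only finitely
many coordinates `S`; a nonzero multiple of any `y` lies in its span, so `s y` is supported on `S`
too, and `S` generates. -/
theorem module_finite_of_projective_of_finrank_ne_zero [Module.Projective R M]
    (h : Module.finrank R M ≠ 0) : Module.Finite R M := by
  classical
  obtain ⟨s, hs⟩ := Module.projective_def'.1 ‹Module.Projective R M›
  obtain ⟨b, -, hb⟩ := exists_linearIndependent_torsion_quotient h rfl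
  let S : Finset M := Finset.univ.biUnion fun i => (s (b i)).support
  have hS : ∀ x ∈ Submodule.span R (Set.range b), s x ∈ Finsupp.supported R R (S : Set M) := by
    intro x hx
    rw [← Submodule.mem_comap]
    refine Submodule.span_le.2 ?_ hx
    rintro _ ⟨i, rfl⟩ y hy
    exact Finset.mem_coe.2 (Finset.mem_biUnion.2 ⟨i, Finset.mem_univ _, hy⟩)
  refine ⟨S, eq_top_iff.2 fun y _ => ?_⟩
  obtain ⟨d, hd, hdy⟩ := hb y
  have hy : s y ∈ Finsupp.supported R R (S : Set M) := by
    have := hS _ hdy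
    rw [map_smul] at this
    intro i hi
    exact this (by simpa [hd] using hi)
  have h1 := LinearMap.congr_fun hs y
  rw [LinearMap.comp_apply, LinearMap.id_apply] at h1
  rw [← h1, Finsupp.linearCombination_apply]
  exact Submodule.sum_mem _ fun i hi => Submodule.smul_mem _ _ (Submodule.subset_span (hy hi))

end Projective

/-! ### The module `Y` in `k^r` and the index of `aY`. -/

section PiBall

variable {k : Type*} [Field k]

namespace Place

/-- The elements of `k^r` whose coordinates lie in `v.ball m`. -/
def piBall (v : Place k) (r : ℕ) (m : ℤ) : AddSubgroup (Fin r → k) :=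
  AddSubgroup.pi Set.univ fun _ => v.ball m

theorem mem_piBall {v : Place k} {r : ℕ} {m : ℤ} {x : Fin r → k} :
    x ∈ v.piBall r m ↔ ∀ i, x i ∈ v.ball m := by
  simp [piBall, AddSubgroup.mem_pi]

theorem relIndex_piBall (v : Place k) (r : ℕ) (m : ℤ) (n : ℕ) :
    (v.piBall r m).relIndex (v.piBall r (m + n)) = (v.q ^ n) ^ r := by
  rw [piBall, piBall, relIndex_pi_const (v.ball_mono (by omega)), relIndex_ball_add,
    Fintype.card_fin]

theorem map_mulLeft_piBall {v : Place k} {c : k} {n : ℤ} (hc : v.val c = exp n) (r : ℕ) (m : ℤ) :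
    (v.piBall r m).map (DistribSMul.toAddMonoidHom (Fin r → k) c) = v.piBall r (m + n) := by
  have h : ∀ x : k, x ∈ v.ball (m + n) ↔ ∃ y ∈ v.ball m, c * y = x := fun x => by
    rw [← map_mulLeft_ball hc]; rfl
  ext x
  simp only [AddSubgroup.mem_map, mem_piBall, h]
  constructor
  · rintro ⟨y, hy, rfl⟩ i
    exact ⟨y i, hy i, rfl⟩
  · intro hx
    choose y hy hxy using hx
    exact ⟨y, hy, funext hxy⟩

variable {v : Place k} {r : ℕ} (Y : Submodule v.ringAway (Fin r → k))

/-- Independent vectors of `Y`, `r` in number, form a `k`-basis; split each coordinate by `k = A +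
ball`. -/
theorem exists_sup_piBall_eq_top [IsFractionRing v.ringAway k] (hr : r ≠ 0)
    (hrank : Module.finrank v.ringAway Y = r) (hA : ∃ m, v.ringAway.toAddSubgroup ⊔ v.ball m = ⊤) :
    ∃ m, Y.toAddSubgroup ⊔ v.piBall r m = ⊤ := by
  obtain ⟨m, hm⟩ := hA
  obtain ⟨b, hb, -⟩ := exists_linearIndependent_torsion_quotient hr hrank
  have hb' : LinearIndependent k fun i => (b i : Fin r → k) :=
    (LinearIndependent.iff_fractionRing v.ringAway k).1
      (hb.map' Y.subtype (Submodule.ker_subtype Y))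
  have : Nonempty (Fin r) := Fin.pos_iff_nonempty.1 (Nat.pos_of_ne_zero hr)
  let e := basisOfLinearIndependentOfCardEqFinrank hb' (by simp)
  choose n hn using fun i j => v.exists_mem_ball ((b i : Fin r → k) j)
  obtain ⟨N, hN⟩ := Finset.exists_le (Finset.univ.image fun p : Fin r × Fin r => n p.1 p.2)
  refine ⟨m + N, eq_top_iff.2 fun x _ => ?_⟩
  choose α hα β hβ hαβ using fun i =>
    AddSubgroup.mem_sup.1 (hm ▸ AddSubgroup.mem_top (e.repr x i) :
      e.repr x i ∈ v.ringAway.toAddSubgroup ⊔ v.ball m)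
  have hx : x = ∑ i, α i • (b i : Fin r → k) + ∑ i, β i • (b i : Fin r → k) := by
    rw [← Finset.sum_add_distrib]
    nth_rw 1 [← e.sum_repr x]
    refine Finset.sum_congr rfl fun i _ => ?_
    rw [← hαβ, add_smul]
    simp [e]
  rw [hx]
  refine AddSubgroup.add_mem_sup (sum_mem fun i _ => ?_) (sum_mem fun i _ => ?_)
  · exact Y.smul_mem ⟨α i, hα i⟩ (b i).2
  · refine mem_piBall.2 fun j => ?_
    refine mul_mem_ball_add (hβ i) (v.ball_mono (hN _ ?_) (hn i j))
    exact Finset.mem_image_of_mem (fun p : Fin r × Fin r => n p.1 p.2) (Finset.mem_univ (i, j))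

/-- A common denominator `d` of generators carries `Y` into `A^r`, where boundedness leaves finitely
many coordinates. -/
theorem finite_inf_piBall [IsFractionRing v.ringAway k] [Module.Finite v.ringAway Y]
    (hA : ∀ m, Finite (v.ringAway.toAddSubgroup ⊓ v.ball m : AddSubgroup k)) (m : ℤ) :
    Finite (Y.toAddSubgroup ⊓ v.piBall r m : AddSubgroup (Fin r → k)) := by
  obtain ⟨S, hS⟩ := Module.Finite.iff_fg.1 ‹Module.Finite v.ringAway Y›
  obtain ⟨d, hd⟩ := IsLocalization.exist_integer_multiples (nonZeroDivisors v.ringAway)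
    (S ×ˢ (Finset.univ : Finset (Fin r))) fun p => p.1 p.2
  have hdY : ∀ y ∈ Y, ∀ i, (d : k) * y i ∈ v.ringAway := by
    intro y hy i
    rw [← hS] at hy
    induction hy using Submodule.span_induction with
    | mem y hy =>
      obtain ⟨c, hc⟩ := hd (y, i) (by simpa using hy)
      have : (c : k) = d * y i := hc
      exact this ▸ c.2
    | zero => simp
    | add x y _ _ hx hy => rw [Pi.add_apply, mul_add]; exact add_mem hx hy
    | smul c x _ hx =>
      have : (d : k) * (c • x) i = c * (d * x i) := by
        rw [Pi.smul_apply, Subring.smul_def, smul_eq_mul]; ring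
      exact this ▸ mul_mem c.2 hx
  have hd0 : ((d : v.ringAway) : k) ≠ 0 := by
    simp
  obtain ⟨n, hn⟩ := v.exists_mem_ball ((d : v.ringAway) : k)
  have := hA (n + m)
  refine Finite.of_injective
    (fun y : (Y.toAddSubgroup ⊓ v.piBall r m : AddSubgroup (Fin r → k)) => fun i : Fin r =>
      (⟨d * (y : Fin r → k) i, hdY _ y.2.1 i, mul_mem_ball_add hn (mem_piBall.1 y.2.2 i)⟩ :
        (v.ringAway.toAddSubgroup ⊓ v.ball (n + m) : AddSubgroup k))) fun x y h => ?_
  ext i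
  exact mul_left_cancel₀ hd0 (congrArg Subtype.val (congrFun h i))

/-- The box `B' = aB` is a larger box, and multiplication by `a` transports both `Y + B = k^r` and
the intersection `Y ∩ B`. Hence the index of `aY` is that of the boxes. -/
theorem relIndex_smul_eq (hY : ∃ m, Y.toAddSubgroup ⊔ v.piBall r m = ⊤)
    (hfin : ∀ m, Finite (Y.toAddSubgroup ⊓ v.piBall r m : AddSubgroup (Fin r → k)))
    {a : k} (ha : a ∈ v.ringAway) {n : ℕ} (han : v.val a = exp (n : ℤ)) :
    (Y.toAddSubgroup.map (DistribSMul.toAddMonoidHom (Fin r → k) a)).relIndex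
      Y.toAddSubgroup = (v.q ^ n) ^ r := by
  have ha0 : a ≠ 0 := by rintro rfl; exact WithZero.exp_ne_zero (v.val.map_zero ▸ han).symm
  have hinj : Function.Injective (DistribSMul.toAddMonoidHom (Fin r → k) a) :=
    smul_right_injective _ ha0
  obtain ⟨m, hm⟩ := hY
  have := hfin m
  rw [relIndex_eq_relIndex_of_sup_eq_top (B := v.piBall r m) (B' := v.piBall r (m + n)) ?_ ?_ hm,
    relIndex_piBall]
  · rw [← map_mulLeft_piBall han, ← AddSubgroup.map_sup, hm, AddSubgroup.map_top_of_surjective]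
    exact fun x => ⟨a⁻¹ • x, smul_inv_smul₀ ha0 x⟩
  · rw [← map_mulLeft_piBall han, ← AddSubgroup.map_inf _ _ _ hinj]
    exact (Nat.card_congr (AddSubgroup.equivMapOfInjective _ _ hinj).toEquiv).symm
  · rintro _ ⟨y, hy, rfl⟩
    exact Y.smul_mem ⟨a, ha⟩ hy
  · intro x hx
    exact mem_piBall.2 fun i => v.ball_mono (by omega) (mem_piBall.1 hx i)

end Place

end PiBall

/-! ### Norm estimates on the period domain and discreteness of the lattice. -/

section Period

variable {k : Type*} [Field k]

namespace Place

theorem norm_embInf (v : Place k) (x : v.KInf) : ‖v.embInf x‖ = ‖x‖ := by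
  rw [embInf, RingHom.comp_apply]
  change ‖((algebraMap v.KInf (AlgebraicClosure v.KInf) x : AlgebraicClosure v.KInf) : v.CInf)‖ = _
  rw [UniformSpace.Completion.norm_coe, norm_algebraMap']

theorem norm_emb (v : Place k) (x : k) : ‖v.emb x‖ = v.abs x := by
  rw [emb, RingHom.comp_apply, norm_embInf]
  change ‖((WithAbs.toAbs v.abs x : WithAbs v.abs) : v.KInf)‖ = _
  rw [UniformSpace.Completion.norm_coe, WithAbs.norm_toAbs_eq]

instance isUltrametricDist_CInf (v : Place k) : IsUltrametricDist v.CInf := by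
  refine IsUltrametricDist.isUltrametricDist_of_forall_norm_natCast_le_one fun n => ?_
  rw [← map_natCast v.embInf, norm_embInf]
  exact IsUltrametricDist.norm_natCast_le_one v.KInf n

end Place

variable {v : Place k} {r : ℕ} [NeZero r] {z : Projectivization v.CInf (Fin r → v.CInf)}

theorem rep_lastIdx_ne_zero (hz : z ∈ periodDomain v r) : z.rep (lastIdx r) ≠ 0 := by
  have := hz (Pi.single (lastIdx r) 1) (by simp)
  simpa [Pi.single_apply, apply_ite v.embInf] using this

theorem sum_embInf_mul_coord_ne_zero (hz : z ∈ periodDomain v r) {c : Fin r → v.KInf} (hc : c ≠ 0) :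
    ∑ i, v.embInf (c i) * coord z i ≠ 0 := by
  have := div_ne_zero (hz c hc) (rep_lastIdx_ne_zero hz)
  rwa [Finset.sum_div, Finset.sum_congr rfl fun i _ => mul_div_assoc _ _ _] at this

/-- Lying on no rational hyperplane means that this linear map is injective, and an injective linear
map from a finite-dimensional space over a complete field is bounded below. -/
theorem exists_mul_norm_le_norm_sum (hz : z ∈ periodDomain v r) :
    ∃ δ > 0, ∀ c : Fin r → v.KInf, δ * ‖c‖ ≤ ‖∑ i, v.embInf (c i) * coord z i‖ := by
  let f : (Fin r → v.KInf) →ₗ[v.KInf] v.CInf :=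
    { toFun := fun c => ∑ i, v.embInf (c i) * coord z i
      map_add' := fun c d => by simp [add_mul, Finset.sum_add_distrib]
      map_smul' := fun t c => by
        have : ∀ x : v.CInf, t • x = v.embInf t * x := fun x => Algebra.smul_def t x
        simp only [Pi.smul_apply, smul_eq_mul, map_mul, RingHom.id_apply, this, Finset.mul_sum,
          mul_assoc] }
  have hf : LinearMap.ker f = ⊥ := LinearMap.ker_eq_bot'.2 fun c hc => by
    by_contra h
    exact sum_embInf_mul_coord_ne_zero hz h hc
  obtain ⟨K, hK, hK'⟩ := f.exists_antilipschitzWith hf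
  refine ⟨(K : ℝ)⁻¹, by positivity, fun c => ?_⟩
  rw [inv_mul_le_iff₀ (by positivity)]
  have := hK'.le_mul_norm_sub c 0
  rwa [map_zero, add_zero, add_zero, norm_neg, norm_neg] at this

theorem totalIm_pos (hz : z ∈ periodDomain v r) : 0 < totalIm z := by
  obtain ⟨δ, hδ, h⟩ := exists_mul_norm_le_norm_sum hz
  refine Finset.prod_pos fun i _ => hδ.trans_le (le_ciInf fun u => ?_)
  -- The coefficient of `coord z i` is `1`, so `‖c‖ ≥ 1` and every norm in the infimum is at least
  -- `δ`.
  let c : Fin r → v.KInf := fun j => if j = i then 1 else if i < j then u j else 0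
  have hsum : coord z i + ∑ j ∈ Finset.Ioi i, v.embInf (u j) * coord z j =
      ∑ j, v.embInf (c j) * coord z j := by
    rw [← Finset.add_sum_erase _ _ (Finset.mem_univ i)]
    congr 1
    · simp [c]
    · refine (Finset.sum_congr rfl fun j hj => ?_).trans (Finset.sum_subset
        (f := fun j => v.embInf (c j) * coord z j) (fun j hj => ?_) fun j hj hj' => ?_)
      · rw [Finset.mem_Ioi] at hj
        simp [c, hj, hj.ne']
      · rw [Finset.mem_Ioi] at hj
        simp [hj.ne']
      · rw [Finset.mem_Ioi] at hj'
        simp [c, hj', Finset.ne_of_mem_erase hj]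
  rw [hsum]
  refine le_trans ?_ (h c)
  have h1 : ‖c i‖ ≤ ‖c‖ := norm_le_pi_norm c i
  have h2 : ‖c i‖ = 1 := by simp [c]
  nlinarith

theorem exists_mul_abs_le_norm_evalMap (hz : z ∈ periodDomain v r) :
    ∃ δ > 0, ∀ (x : Fin r → k) (i : Fin r), δ * v.abs (x i) ≤ ‖evalMap z x‖ := by
  obtain ⟨δ, hδ, h⟩ := exists_mul_norm_le_norm_sum hz
  refine ⟨δ, hδ, fun x i => ?_⟩
  refine le_trans ?_ (h fun i => algebraMap k v.KInf (x i))
  refine mul_le_mul_of_nonneg_left ?_ hδ.le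
  have := norm_le_pi_norm (fun i => algebraMap k v.KInf (x i)) i
  rwa [← v.norm_embInf, ← RingHom.comp_apply, ← Place.emb, v.norm_emb] at this

theorem evalMap_injective (hz : z ∈ periodDomain v r) : Function.Injective (evalMap z) := by
  obtain ⟨δ, hδ, h⟩ := exists_mul_abs_le_norm_evalMap hz
  refine (injective_iff_map_eq_zero _).2 fun x hx => funext fun i => ?_
  have h1 := h x i
  rw [hx, norm_zero] at h1
  have h2 : v.abs (x i) ≤ 0 := by
    by_contra h3
    exact absurd h1 (mul_pos hδ (not_le.1 h3)).not_ge
  exact v.abs.eq_zero.1 (h2.antisymm (v.abs.nonneg _))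

theorem evalMap_smul (z : Projectivization v.CInf (Fin r → v.CInf)) (a : k) (x : Fin r → k) :
    evalMap z (a • x) = v.emb a * evalMap z x := by
  change ∑ i, v.emb (a * x i) * coord z i = v.emb a * ∑ i, v.emb (x i) * coord z i
  rw [Finset.mul_sum]
  simp [mul_assoc]

theorem mulLattice_lattice (Y : Submodule v.ringAway (Fin r → k))
    (z : Projectivization v.CInf (Fin r → v.CInf)) (a : k) :
    mulLattice a (lattice Y z) =
      (Y.toAddSubgroup.map (DistribSMul.toAddMonoidHom (Fin r → k) a)).map (evalMap z) := by
  rw [mulLattice, lattice, AddSubgroup.map_map, AddSubgroup.map_map]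
  congr 1
  ext x
  exact (evalMap_smul z a _).symm

theorem relIndex_mulLattice (hz : z ∈ periodDomain v r) (Y : Submodule v.ringAway (Fin r → k))
    (a : k) : (mulLattice a (lattice Y z)).relIndex (lattice Y z) =
      (Y.toAddSubgroup.map (DistribSMul.toAddMonoidHom (Fin r → k) a)).relIndex
        Y.toAddSubgroup := by
  rw [mulLattice_lattice, lattice,
    AddSubgroup.relIndex_map_map_of_injective _ _ (evalMap_injective hz)]

theorem finite_lattice_inf_ball (hz : z ∈ periodDomain v r) (Y : Submodule v.ringAway (Fin r → k))
    (hfin : ∀ m, Finite (Y.toAddSubgroup ⊓ v.piBall r m : AddSubgroup (Fin r → k))) (ρ : ℝ) :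
    {l : v.CInf | l ∈ lattice Y z ∧ ‖l‖ ≤ ρ}.Finite := by
  obtain ⟨δ, hδ, h⟩ := exists_mul_abs_le_norm_evalMap hz
  obtain ⟨n, hn⟩ := pow_unbounded_of_one_lt (ρ / δ)
    (show (1 : ℝ) < v.base by exact_mod_cast v.one_lt_base)
  have hS : Set.Finite (↑(Y.toAddSubgroup ⊓ v.piBall r n) : Set (Fin r → k)) := hfin n
  refine (hS.image (evalMap z)).subset ?_
  rintro _ ⟨⟨y, hy, rfl⟩, hl⟩
  refine ⟨y, ⟨hy, Place.mem_piBall.2 fun i => v.abs_le_zpow_iff.1 ?_⟩, rfl⟩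
  rw [zpow_natCast]
  refine le_trans ?_ hn.le
  rw [le_div_iff₀ hδ, mul_comm]
  exact (h y i).trans hl

end Period

/-! ### Convergence of lattice sums and their decomposition into cosets. -/

section LatticeSums

variable {k : Type*} [Field k] {v : Place k}

theorem mem_mulLattice {a : k} {L : AddSubgroup v.CInf} {x : v.CInf} :
    x ∈ mulLattice a L ↔ ∃ l ∈ L, v.emb a * l = x := Iff.rfl

theorem mem_divLattice {a : k} {L : AddSubgroup v.CInf} {x : v.CInf} :
    x ∈ divLattice a L ↔ v.emb a * x ∈ L := Iff.rfl

theorem mulLattice_divLattice {a : k} (ha : a ≠ 0) (L : AddSubgroup v.CInf) :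
    mulLattice a (divLattice a L) = L := by
  have ha' : v.emb a ≠ 0 := by simpa using ha
  ext x
  rw [mem_mulLattice]
  constructor
  · rintro ⟨l, hl, rfl⟩
    exact hl
  · refine fun hx => ⟨(v.emb a)⁻¹ * x, ?_, mul_inv_cancel_left₀ ha' x⟩
    rwa [mem_divLattice, mul_inv_cancel_left₀ ha']

theorem mulLattice_inv {a : k} (ha : a ≠ 0) (L : AddSubgroup v.CInf) :
    mulLattice a⁻¹ L = divLattice a L := by
  have ha' : v.emb a ≠ 0 := by simpa using ha
  ext x
  rw [mem_mulLattice, mem_divLattice, map_inv₀]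
  constructor
  · rintro ⟨l, hl, rfl⟩
    rwa [mul_inv_cancel_left₀ ha']
  · exact fun hx => ⟨_, hx, inv_mul_cancel_left₀ ha' x⟩

theorem relIndex_divLattice {a : k} (ha : a ≠ 0) (L : AddSubgroup v.CInf) :
    L.relIndex (divLattice a L) = (mulLattice a L).relIndex L := by
  have ha' : v.emb a ≠ 0 := by simpa using ha
  nth_rw 4 [← mulLattice_divLattice ha L]
  exact (AddSubgroup.relIndex_map_map_of_injective _ _ (mul_right_injective₀ ha')).symm

/-- The closed ball of radius `ρ` in `ℂ_∞` as an additive subgroup. -/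
def normBall (v : Place k) (ρ : ℝ≥0) : AddSubgroup v.CInf where
  carrier := {x | ‖x‖ ≤ ρ}
  zero_mem' := by simp
  add_mem' hx hy := (IsUltrametricDist.norm_add_le_max _ _).trans (max_le hx hy)
  neg_mem' hx := by simpa using hx

theorem mem_normBall {ρ : ℝ≥0} {x : v.CInf} : x ∈ normBall v ρ ↔ ‖x‖ ≤ ρ := Iff.rfl

/-- The points of `aL` in the large ball are `a` times the points of `L` in the small one, and
intersecting with a ball does not increase the index of `aL` in `L`. -/
theorem card_inf_normBall_mul_le {a : k} {b : ℝ≥0} (hb : v.abs a = b) (hb0 : 0 < b)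
    {L : AddSubgroup v.CInf} (haL : mulLattice a L ≤ L) (hQ : (mulLattice a L).relIndex L ≠ 0)
    (ρ : ℝ≥0) :
    Nat.card (L ⊓ normBall v (b * ρ) : AddSubgroup v.CInf) ≤
      (mulLattice a L).relIndex L * Nat.card (L ⊓ normBall v ρ : AddSubgroup v.CInf) := by
  have ha0 : v.emb a ≠ 0 := by
    rw [← norm_ne_zero_iff, v.norm_emb, hb]
    exact_mod_cast hb0.ne'
  have h1 : mulLattice a L ⊓ normBall v (b * ρ) = mulLattice a (L ⊓ normBall v ρ) := by
    ext x
    rw [AddSubgroup.mem_inf, mem_mulLattice, mem_mulLattice]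
    constructor
    · rintro ⟨⟨l, hl, rfl⟩, hx⟩
      refine ⟨l, ⟨hl, ?_⟩, rfl⟩
      rw [mem_normBall, norm_mul, v.norm_emb, hb] at hx
      exact le_of_mul_le_mul_left (by exact_mod_cast hx) (NNReal.coe_pos.2 hb0)
    · rintro ⟨l, ⟨hl, hl'⟩, rfl⟩
      refine ⟨⟨l, hl, rfl⟩, ?_⟩
      rw [mem_normBall, norm_mul, v.norm_emb, hb]
      push_cast
      exact mul_le_mul_of_nonneg_left hl' b.2
  have h2 : Nat.card (mulLattice a (L ⊓ normBall v ρ)) =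
      Nat.card (L ⊓ normBall v ρ : AddSubgroup v.CInf) :=
    (Nat.card_congr (AddSubgroup.equivMapOfInjective _ _ (mul_right_injective₀ ha0)).toEquiv).symm
  rw [← AddSubgroup.relIndex_bot_left (L ⊓ normBall v (b * ρ)), ← AddSubgroup.relIndex_mul_relIndex
    _ _ _ bot_le (inf_le_inf_right _ haL), AddSubgroup.relIndex_bot_left, h1, h2, mul_comm, ← h1]
  refine Nat.mul_le_mul_right _ ?_
  rw [show mulLattice a L ⊓ normBall v (b * ρ) = mulLattice a L ⊓ (L ⊓ normBall v (b * ρ)) by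
    rw [← inf_assoc, inf_eq_left.2 haL], AddSubgroup.inf_relIndex_right]
  exact AddSubgroup.relIndex_le_of_le_right inf_le_left hQ

theorem card_inf_normBall_pow_le {a : k} {b : ℝ≥0} (hb : v.abs a = b) (hb0 : 0 < b)
    {L : AddSubgroup v.CInf} (haL : mulLattice a L ≤ L) (hQ : (mulLattice a L).relIndex L ≠ 0)
    (n : ℕ) :
    Nat.card (L ⊓ normBall v (b ^ n) : AddSubgroup v.CInf) ≤
      (mulLattice a L).relIndex L ^ n * Nat.card (L ⊓ normBall v 1 : AddSubgroup v.CInf) := by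
  induction n with
  | zero => simp
  | succ n ih =>
    rw [pow_succ' b, pow_succ', mul_assoc]
    exact (card_inf_normBall_mul_le hb hb0 haL hQ _).trans (Nat.mul_le_mul_left _ ih)

/-- The shell `b^n < |l| ≤ b^(n+1)` has at most a constant times `Q^(n+1)` points, each contributing
at most `b^(-tn)`; the ratio `Q * b^(-t)` is below `1`. -/
theorem summable_norm_rpow {a : k} (ha1 : 1 < v.abs a)
    {L : AddSubgroup v.CInf} (hfin : ∀ ρ : ℝ, {l : v.CInf | l ∈ L ∧ ‖l‖ ≤ ρ}.Finite)
    (haL : mulLattice a L ≤ L) (hQ : (mulLattice a L).relIndex L ≠ 0) {t : ℝ}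
    (hQt : ((mulLattice a L).relIndex L : ℝ) < v.abs a ^ t) (ht : 0 ≤ t) :
    Summable fun l : {l : v.CInf // l ∈ L ∧ l ≠ 0} => ‖(l : v.CInf)‖ ^ (-t) := by
  obtain ⟨b, hb⟩ : ∃ b : ℝ≥0, v.abs a = b := ⟨⟨v.abs a, v.abs.nonneg _⟩, rfl⟩
  rw [hb] at ha1 hQt
  have hb0 : (0 : ℝ) < b := zero_lt_one.trans ha1
  set Q : ℕ := (mulLattice a L).relIndex L
  let N : {l : v.CInf // l ∈ L ∧ l ≠ 0} → ℕ := fun l => ⌈Real.logb b ‖(l : v.CInf)‖⌉₊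
  have hN1 : ∀ l : {l : v.CInf // l ∈ L ∧ l ≠ 0}, ‖(l : v.CInf)‖ ≤ b ^ N l := fun l => by
    have := Nat.le_ceil (Real.logb b ‖(l : v.CInf)‖)
    rwa [Real.logb_le_iff_le_rpow ha1 (norm_pos_iff.2 l.2.2), Real.rpow_natCast] at this
  have hN2 : ∀ (l : {l : v.CInf // l ∈ L ∧ l ≠ 0}) (n : ℕ), N l = n + 1 →
      (b : ℝ) ^ n < ‖(l : v.CInf)‖ := fun l n h => by
    have := Nat.lt_ceil.1 (show n < N l by omega)
    rwa [Real.lt_logb_iff_rpow_lt ha1 (norm_pos_iff.2 l.2.2), Real.rpow_natCast] at this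
  have hfb : ∀ n, Finite (L ⊓ normBall v (b ^ n) : AddSubgroup v.CInf) := fun n => by
    refine (hfin (b ^ n)).subset fun x hx => ⟨hx.1, ?_⟩
    exact_mod_cast mem_normBall.1 hx.2
  let j : ∀ n, {l // N l = n} → (L ⊓ normBall v (b ^ n) : AddSubgroup v.CInf) := fun n l =>
    ⟨l.1, l.1.2.1, mem_normBall.2 (by have := hN1 l.1; rw [l.2] at this; exact_mod_cast this)⟩
  have hj : ∀ n, Function.Injective (j n) := fun n x y h =>
    Subtype.ext (Subtype.ext (congrArg
      (fun z : (L ⊓ normBall v (b ^ n) : AddSubgroup v.CInf) => (z : v.CInf)) h))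
  have hff : ∀ n, Finite {l // N l = n} := fun n => Finite.of_injective _ (hj n)
  rw [← (Equiv.sigmaFiberEquiv N).summable_iff, summable_sigma_of_nonneg fun _ => by
    exact Real.rpow_nonneg (norm_nonneg _) _]
  refine ⟨fun n => Summable.of_finite, ?_⟩
  have hq0 : (0 : ℝ) ≤ Q * (b : ℝ) ^ (-t) := by positivity
  have hq1 : Q * (b : ℝ) ^ (-t) < 1 := by
    rwa [Real.rpow_neg hb0.le, ← div_eq_mul_inv, div_lt_one (by positivity)]
  -- The natural ceiling puts all points with `|l| ≤ 1` in shell `0`, which has no lower bound on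
  -- norms; it is finite and is dropped.
  rw [← summable_nat_add_iff 1]
  refine Summable.of_nonneg_of_le (fun n => tsum_nonneg fun _ => Real.rpow_nonneg (norm_nonneg _) _)
    (fun n => ?_) ((summable_geometric_of_lt_one hq0 hq1).mul_left
      (Q * Nat.card (L ⊓ normBall v 1 : AddSubgroup v.CInf) : ℝ))
  have := Fintype.ofFinite {l // N l = n + 1}
  have hcard : (Fintype.card {l // N l = n + 1} : ℝ) ≤
      Q ^ (n + 1) * Nat.card (L ⊓ normBall v 1 : AddSubgroup v.CInf) := by
    have hf := hfb (n + 1)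
    have h1 := Nat.card_le_card_of_injective _ (hj (n + 1))
    rw [Nat.card_eq_fintype_card] at h1
    exact_mod_cast h1.trans (card_inf_normBall_pow_le hb (NNReal.coe_pos.1 hb0) haL hQ (n + 1))
  rw [tsum_fintype]
  have hterm : ∀ l : {l // N l = n + 1}, ‖(l.1 : v.CInf)‖ ^ (-t) ≤ ((b : ℝ) ^ (-t)) ^ n := fun l => by
    rw [← Real.rpow_natCast, ← Real.rpow_mul hb0.le, mul_comm, Real.rpow_mul hb0.le,
      Real.rpow_natCast]
    exact Real.rpow_le_rpow_of_nonpos (by positivity) (hN2 l.1 n l.2).le (by linarith)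
  refine (Finset.sum_le_card_nsmul _ _ _ fun l _ => hterm l).trans ?_
  rw [Finset.card_univ, nsmul_eq_mul]
  refine (mul_le_mul_of_nonneg_right hcard (by positivity)).trans_eq ?_
  rw [mul_pow, pow_succ]
  ring

/-- The terms with `|l| > |w|` cancel because `|w - l| = |l|`, and `l = 0` leaves `g ‖w‖` since `g 0
= 0`. -/
theorem tsum_sub_eq_bracket_add {L : AddSubgroup v.CInf}
    (hfin : ∀ ρ : ℝ, {l : v.CInf | l ∈ L ∧ ‖l‖ ≤ ρ}.Finite) {g : ℝ → ℂ} (hg : g 0 = 0)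
    (hL : Summable fun l : L => g ‖(l : v.CInf)‖) {w : v.CInf}
    (hLw : Summable fun l : L => g ‖w - l‖) :
    ∑' l : L, g ‖w - l‖ = bracket L g w + ∑' l : L, g ‖(l : v.CInf)‖ := by
  classical
  rw [← sub_eq_iff_eq_add, ← hLw.tsum_sub hL]
  have hT : {l : v.CInf | l ∈ L ∧ l ≠ 0 ∧ ‖l‖ ≤ ‖w‖}.Finite :=
    (hfin ‖w‖).subset fun l hl => ⟨hl.1, hl.2.2⟩
  have hsub : ∑' l : L, (g ‖w - l‖ - g ‖(l : v.CInf)‖) =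
      ∑' l, (L : Set v.CInf).indicator (fun l => g ‖w - l‖ - g ‖l‖) l :=
    tsum_subtype (L : Set v.CInf) fun l => g ‖w - l‖ - g ‖l‖
  rw [hsub, tsum_eq_sum (s := insert 0 hT.toFinset), Finset.sum_insert (by simp), bracket,
    finsum_mem_eq_finite_toFinset_sum _ hT]
  · congr 1
    · rw [Set.indicator_of_mem (zero_mem L), sub_zero, norm_zero, hg, sub_zero]
    · refine Finset.sum_congr rfl fun l hl => ?_
      rw [Set.Finite.mem_toFinset] at hl
      rw [Set.indicator_of_mem hl.1, norm_sub_rev]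
  · intro l hl
    refine Set.indicator_apply_eq_zero.2 fun hlL => ?_
    simp only [Finset.mem_insert, Set.Finite.mem_toFinset, Set.mem_ofPred_eq, not_or, not_and,
      not_le] at hl
    have hlt := hl.2 hlL hl.1
    have hnorm : ‖w - l‖ = ‖l‖ := by
      rw [sub_eq_add_neg, IsUltrametricDist.norm_add_eq_max_of_norm_ne_norm
        (by rw [norm_neg]; exact hlt.ne), norm_neg, max_eq_right hlt.le]
    rw [hnorm, sub_self]

/-- A choice `σ` of representatives of `M / L` identifies `(M / L) × L` with `M` through
`(c, l) ↦ σ c - l`. -/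
noncomputable def quotientProdEquiv {G : Type*} [AddCommGroup G] {L M : AddSubgroup G} (hLM : L ≤ M)
    {σ : M ⧸ L.addSubgroupOf M → M} (hσ : ∀ c, QuotientAddGroup.mk (σ c) = c) :
    (M ⧸ L.addSubgroupOf M) × L ≃ M where
  toFun p := ⟨σ p.1 - p.2, sub_mem (σ p.1).2 (hLM p.2.2)⟩
  invFun m := (QuotientAddGroup.mk m, ⟨σ (QuotientAddGroup.mk m) - m, by
    have := QuotientAddGroup.eq.1 (hσ (QuotientAddGroup.mk m)).symm
    rw [AddSubgroup.mem_addSubgroupOf] at this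
    rw [sub_eq_neg_add]
    exact this⟩)
  left_inv p := by
    have h : (QuotientAddGroup.mk (⟨σ p.1 - p.2, sub_mem (σ p.1).2 (hLM p.2.2)⟩ : M) :
        M ⧸ L.addSubgroupOf M) = p.1 := by
      rw [← hσ p.1, QuotientAddGroup.eq, AddSubgroup.mem_addSubgroupOf, hσ]
      simp
    ext
    · exact h
    · simp [h]
  right_inv m := by simp

theorem summable_of_addSubgroup_le {G : Type*} [AddCommGroup G] {L M : AddSubgroup G} (hLM : L ≤ M)
    {f : G → ℂ} (hM : Summable fun m : M => f m) : Summable fun l : L => f l :=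
  hM.comp_injective (i := AddSubgroup.inclusion hLM) (AddSubgroup.inclusion_injective hLM)

theorem summable_quotientProd {G : Type*} [AddCommGroup G] {L M : AddSubgroup G} (hLM : L ≤ M)
    {σ : M ⧸ L.addSubgroupOf M → M} (hσ : ∀ c, QuotientAddGroup.mk (σ c) = c) {f : G → ℂ}
    (hM : Summable fun m : M => f m) :
    Summable fun p : (M ⧸ L.addSubgroupOf M) × L => f (σ p.1 - p.2) :=
  ((quotientProdEquiv hLM hσ).summable_iff (f := fun m : M => f m)).2 hM

theorem tsum_eq_sum_tsum_sub {G : Type*} [AddCommGroup G] {L M : AddSubgroup G} (hLM : L ≤ M)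
    [Fintype (M ⧸ L.addSubgroupOf M)]
    {σ : M ⧸ L.addSubgroupOf M → M} (hσ : ∀ c, QuotientAddGroup.mk (σ c) = c) {f : G → ℂ}
    (hM : Summable fun m : M => f m) :
    ∑' m : M, f m = ∑ c, ∑' l : L, f (σ c - l) := by
  have h1 : ∑' p : (M ⧸ L.addSubgroupOf M) × L, f (σ p.1 - p.2) = ∑' m : M, f m :=
    (quotientProdEquiv hLM hσ).tsum_eq fun m : M => f m
  rw [← h1, (summable_quotientProd hLM hσ hM).tsum_prod, tsum_fintype]

/-- The representative of the zero class may be any element of `L`; translation by it permutes `L`.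
-/
theorem tsum_sub_zero_class {G : Type*} [AddCommGroup G] {L M : AddSubgroup G}
    {σ : M ⧸ L.addSubgroupOf M → M} (hσ : ∀ c, QuotientAddGroup.mk (σ c) = c) (f : G → ℂ) :
    ∑' l : L, f (σ 0 - l) = ∑' l : L, f l := by
  have hσ0 : (σ 0 : G) ∈ L :=
    AddSubgroup.mem_addSubgroupOf.1 ((QuotientAddGroup.eq_zero_iff _).1 (hσ 0))
  exact (Equiv.subLeft (⟨σ 0, hσ0⟩ : L)).tsum_eq fun l : L => f l

/-- Every class contributes the sum over `L`, and each nonzero class its bracket in addition. -/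
theorem tsum_eq_cosetSum_add {L M : AddSubgroup v.CInf} (hLM : L ≤ M)
    (hfin : ∀ ρ : ℝ, {l : v.CInf | l ∈ L ∧ ‖l‖ ≤ ρ}.Finite) [Finite (LatQuot M L)]
    {σ : LatQuot M L → M} (hσ : ∀ c, QuotientAddGroup.mk (σ c) = c) {g : ℝ → ℂ} (hg : g 0 = 0)
    (hM : Summable fun m : M => g ‖(m : v.CInf)‖) :
    ∑' m : M, g ‖(m : v.CInf)‖ =
      L.relIndex M * ∑' l : L, g ‖(l : v.CInf)‖ + cosetSum M L σ g := by
  classical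
  have := Fintype.ofFinite (LatQuot M L)
  have hL : Summable fun l : L => g ‖(l : v.CInf)‖ :=
    summable_of_addSubgroup_le hLM (f := fun x => g ‖x‖) hM
  have hc : ∀ c, Summable fun l : L => g ‖(σ c : v.CInf) - l‖ :=
    (summable_quotientProd hLM hσ (f := fun x => g ‖x‖) hM).prod_factor
  have hterm : ∀ c, ∑' l : L, g ‖(σ c : v.CInf) - l‖ = ∑' l : L, g ‖(l : v.CInf)‖ +
      Set.indicator {c | c ≠ 0} (fun c => bracket L g (σ c : v.CInf)) c := by
    intro c
    by_cases h : c = 0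
    · rw [h, tsum_sub_zero_class hσ (fun x => g ‖x‖), Set.indicator_of_notMem (by simp), add_zero]
    · rw [tsum_sub_eq_bracket_add hfin hg hL (hc c), Set.indicator_of_mem h, add_comm]
  rw [tsum_eq_sum_tsum_sub hLM hσ (f := fun x => g ‖x‖) hM, cosetSum, finsum_mem_def,
    finsum_eq_sum_of_fintype, Finset.sum_congr rfl fun c _ => hterm c, Finset.sum_add_distrib,
    Finset.sum_const, Finset.card_univ, nsmul_eq_mul, AddSubgroup.relIndex, AddSubgroup.index,
    Nat.card_eq_fintype_card]

theorem indicator_nonzero_eq {L : AddSubgroup v.CInf} {g : v.CInf → ℂ} (hg : g 0 = 0) :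
    Set.indicator {l : v.CInf | l ∈ L ∧ l ≠ 0} g = Set.indicator (L : Set v.CInf) g := by
  ext x
  by_cases hL : x ∈ L
  · rw [Set.indicator_of_mem (show x ∈ (L : Set v.CInf) from hL)]
    by_cases hx : x = 0
    · rw [Set.indicator_of_notMem fun h => h.2 hx, hx, hg]
    · rw [Set.indicator_of_mem (show x ∈ {l : v.CInf | l ∈ L ∧ l ≠ 0} from ⟨hL, hx⟩)]
  · rw [Set.indicator_of_notMem (show x ∉ (L : Set v.CInf) from hL),
      Set.indicator_of_notMem fun h => hL h.1]

theorem summable_nonzero_iff {L : AddSubgroup v.CInf} {g : v.CInf → ℂ} (hg : g 0 = 0) :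
    (Summable fun l : {l : v.CInf // l ∈ L ∧ l ≠ 0} => g l) ↔ Summable fun l : L => g l := by
  have h := summable_subtype_iff_indicator (f := g) (s := {l : v.CInf | l ∈ L ∧ l ≠ 0})
  rw [indicator_nonzero_eq hg, ← summable_subtype_iff_indicator] at h
  exact h

theorem tsum_nonzero_eq {L : AddSubgroup v.CInf} {g : v.CInf → ℂ} (hg : g 0 = 0) :
    ∑' l : {l : v.CInf // l ∈ L ∧ l ≠ 0}, g l = ∑' l : L, g l :=
  (tsum_subtype {l : v.CInf | l ∈ L ∧ l ≠ 0} g).trans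
    ((congrArg tsum (indicator_nonzero_eq hg)).trans (tsum_subtype (L : Set v.CInf) g).symm)

/-- Multiplication by `a` as a bijection `L ≃ a L`. -/
noncomputable def mulLatticeEquiv {a : k} (ha : a ≠ 0) (L : AddSubgroup v.CInf) :
    L ≃ mulLattice a L :=
  (AddSubgroup.equivMapOfInjective _ _
    (mul_right_injective₀ (show v.emb a ≠ 0 by simpa using ha))).toEquiv

theorem coe_mulLatticeEquiv {a : k} (ha : a ≠ 0) (L : AddSubgroup v.CInf) (l : L) :
    (mulLatticeEquiv ha L l : v.CInf) = v.emb a * l := rfl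

theorem norm_mulLatticeEquiv {a : k} (ha : a ≠ 0) (L : AddSubgroup v.CInf) (l : L) :
    ‖(mulLatticeEquiv ha L l : v.CInf)‖ = v.abs a * ‖(l : v.CInf)‖ := by
  rw [coe_mulLatticeEquiv, norm_mul, v.norm_emb]

end LatticeSums

/-! ### Termwise differentiation of finite combinations of evaluations. -/

section Evaluations

/-- The span of the evaluations `f ↦ f x` at positive reals `x`. -/
def posEvalSpan : Submodule ℂ ((ℝ → ℂ) → ℂ) :=
  Submodule.span ℂ {Φ | ∃ x : ℝ, 0 < x ∧ Φ = fun f => f x}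

theorem eval_mem_posEvalSpan {x : ℝ} (hx : 0 < x) :
    (fun f : ℝ → ℂ => f x) ∈ posEvalSpan := Submodule.subset_span ⟨x, hx, rfl⟩

theorem one_div_cpow_eq_cexp {x : ℝ} (hx : 0 < x) (r s : ℂ) :
    1 / (x : ℂ) ^ (r * s) = Complex.exp (-r * Real.log x * s) := by
  rw [Complex.cpow_def_of_ne_zero (by exact_mod_cast hx.ne'), one_div, ← Complex.exp_neg,
    ← Complex.ofReal_log hx.le]
  congr 1
  ring

/-- Both claims are linear in `Φ`, and for one evaluation `x^(-rs)` is the exponential `exp (-r log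
x · s)`. -/
theorem differentiable_and_iteratedDeriv_of_mem_posEvalSpan (r : ℂ) {Φ : (ℝ → ℂ) → ℂ}
    (hΦ : Φ ∈ posEvalSpan) :
    (Differentiable ℂ fun s : ℂ => Φ fun x => 1 / (x : ℂ) ^ (r * s)) ∧
      ∀ n : ℕ, iteratedDeriv n (fun s : ℂ => Φ fun x => 1 / (x : ℂ) ^ (r * s)) 0 =
        (-r) ^ n * Φ fun x => ((Real.log x ^ n : ℝ) : ℂ) := by
  induction hΦ using Submodule.span_induction with
  | mem Φ h =>
    obtain ⟨x, hx, rfl⟩ := h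
    simp only [one_div_cpow_eq_cexp hx]
    refine ⟨by fun_prop, fun n => ?_⟩
    rw [iteratedDeriv_cexp_const_mul]
    simp only [mul_zero, Complex.exp_zero, mul_one, mul_pow, Complex.ofReal_pow]
  | zero =>
    refine ⟨differentiable_const _, fun n => ?_⟩
    simp only [Pi.zero_apply, mul_zero]
    cases n <;> simp
  | add Φ Ψ _ _ h1 h2 =>
    refine ⟨h1.1.add h2.1, fun n => ?_⟩
    have := iteratedDeriv_add (n := n) (x := (0 : ℂ)) h1.1.contDiff.contDiffAt
      h2.1.contDiff.contDiffAt
    refine this.trans ?_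
    rw [h1.2, h2.2, Pi.add_apply, mul_add]
  | smul c Φ _ h =>
    refine ⟨h.1.const_smul c, fun n => ?_⟩
    have := iteratedDeriv_const_smul (n := n) (x := (0 : ℂ)) h.1.contDiff.contDiffAt c
    refine this.trans ?_
    rw [h.2, Pi.smul_apply, smul_eq_mul, smul_eq_mul]
    ring

end Evaluations

/-! ### Coset sums are finite combinations of evaluations at positive reals. -/

section CosetSum

variable {k : Type*} [Field k] {v : Place k}

theorem bracket_mem_posEvalSpan {L : AddSubgroup v.CInf}
    (hfin : ∀ ρ : ℝ, {l : v.CInf | l ∈ L ∧ ‖l‖ ≤ ρ}.Finite) {w : v.CInf} (hw : w ∉ L) :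
    (fun f => bracket L f w) ∈ posEvalSpan := by
  have hT : {l : v.CInf | l ∈ L ∧ l ≠ 0 ∧ ‖l‖ ≤ ‖w‖}.Finite :=
    (hfin ‖w‖).subset fun l hl => ⟨hl.1, hl.2.2⟩
  have hw0 : w ≠ 0 := fun h => hw (h ▸ zero_mem L)
  have h : (fun f => bracket L f w) = (fun f : ℝ → ℂ => f ‖w‖) +
      ∑ l ∈ hT.toFinset, ((fun f : ℝ → ℂ => f ‖l - w‖) - fun f : ℝ → ℂ => f ‖l‖) := by
    ext f
    simp only [bracket, Pi.add_apply, Finset.sum_apply, Pi.sub_apply]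
    rw [finsum_mem_eq_finite_toFinset_sum _ hT]
  rw [h]
  refine add_mem (eval_mem_posEvalSpan (norm_pos_iff.2 hw0)) (sum_mem fun l hl => ?_)
  rw [Set.Finite.mem_toFinset] at hl
  refine sub_mem (eval_mem_posEvalSpan (norm_pos_iff.2 ?_))
    (eval_mem_posEvalSpan (norm_pos_iff.2 hl.2.1))
  -- Since `w ∉ L`, no `l - w` vanishes, so every evaluation point is positive.
  exact sub_ne_zero.2 fun h => hw (h ▸ hl.1)

theorem cosetSum_mem_posEvalSpan {L M : AddSubgroup v.CInf}
    (hfin : ∀ ρ : ℝ, {l : v.CInf | l ∈ L ∧ ‖l‖ ≤ ρ}.Finite) [Finite (LatQuot M L)]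
    {σ : LatQuot M L → M} (hσ : ∀ c, QuotientAddGroup.mk (σ c) = c) :
    (fun f => cosetSum M L σ f) ∈ posEvalSpan := by
  have hT : {c : LatQuot M L | c ≠ 0}.Finite := Set.toFinite _
  have h : (fun f => cosetSum M L σ f) =
      ∑ c ∈ hT.toFinset, fun f : ℝ → ℂ => bracket L f (σ c : v.CInf) := by
    ext f
    rw [cosetSum, finsum_mem_eq_finite_toFinset_sum _ hT, Finset.sum_apply]
  rw [h]
  refine sum_mem fun c hc => bracket_mem_posEvalSpan hfin fun h => ?_
  rw [Set.Finite.mem_toFinset] at hc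
  exact hc (hσ c ▸ (QuotientAddGroup.eq_zero_iff _).2 (AddSubgroup.mem_addSubgroupOf.2 h))

end CosetSum

/-! ### Uniqueness of the continuation and its construction as a quotient. -/

section Continuation

/-- By the identity theorem the difference has infinite order everywhere; functions in normal form
that agree on punctured neighbourhoods agree at the centre. -/
theorem eq_of_meromorphicNFOn_of_eqOn {f g : ℂ → ℂ} (hf : MeromorphicNFOn f Set.univ)
    (hg : MeromorphicNFOn g Set.univ) {U : Set ℂ} (hU : IsOpen U) (hne : U.Nonempty)
    (h : Set.EqOn f g U) : f = g := by
  obtain ⟨x₀, hx₀⟩ := hne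
  have hm : MeromorphicOn (f - g) Set.univ := hf.meromorphicOn.sub hg.meromorphicOn
  have htop : ∀ x, meromorphicOrderAt (f - g) x = ⊤ := by
    by_contra! hc
    obtain ⟨x, hx⟩ := hc
    have h1 := (hm.exists_meromorphicOrderAt_ne_top_iff_forall isConnected_univ).1
      ⟨⟨x, Set.mem_univ _⟩, hx⟩ ⟨x₀, Set.mem_univ _⟩
    refine h1 (meromorphicOrderAt_eq_top_iff.2 ?_)
    filter_upwards [nhdsWithin_le_nhds (hU.mem_nhds hx₀)] with y hy
    rw [Pi.sub_apply, h hy, sub_self]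
  funext x
  have hx : f =ᶠ[𝓝[≠] x] g := by
    filter_upwards [meromorphicOrderAt_eq_top_iff.1 (htop x)] with y hy
    exact sub_eq_zero.1 hy
  exact ((MeromorphicNFAt.eventuallyEq_nhdsNE_iff_eventuallyEq_nhds (hf (Set.mem_univ x))
    (hg (Set.mem_univ x))).1 hx).eq_of_nhds

variable {k : Type*} [Field k] {v : Place k} {r : ℕ} [NeZero r]
  {Y : Submodule v.ringAway (Fin r → k)} {z : Projectivization v.CInf (Fin r → v.CInf)}

theorem IsEisenstein.unique {E E' : ℂ → ℂ} (h : IsEisenstein Y z E) (h' : IsEisenstein Y z E') :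
    E = E' :=
  eq_of_meromorphicNFOn_of_eqOn h.1 h'.1 (U := {s | 1 < s.re})
    (isOpen_lt continuous_const Complex.continuous_re) ⟨2, by simp⟩
    fun s hs => (h.2 s hs).trans (h'.2 s hs).symm

/-- The function `Im(z) ^ s / D(s) * N(s)`. -/
noncomputable def quotientForm (z : Projectivization v.CInf (Fin r → v.CInf)) (D N : ℂ → ℂ)
    (s : ℂ) : ℂ := (totalIm z : ℂ) ^ s / D s * N s

theorem differentiable_totalIm_cpow (hz : z ∈ periodDomain v r) :
    Differentiable ℂ fun s : ℂ => (totalIm z : ℂ) ^ s := fun _ =>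
  differentiableAt_id.const_cpow (Or.inl (by exact_mod_cast (totalIm_pos hz).ne'))

theorem analyticAt_quotientForm (hz : z ∈ periodDomain v r) {D N : ℂ → ℂ}
    (hD : Differentiable ℂ D) (hN : Differentiable ℂ N) {s : ℂ} (hs : D s ≠ 0) :
    AnalyticAt ℂ (quotientForm z D N) s :=
  (((differentiable_totalIm_cpow hz).analyticAt s).div (hD.analyticAt s) hs).mul (hN.analyticAt s)

theorem meromorphicOn_quotientForm (hz : z ∈ periodDomain v r) {D N : ℂ → ℂ}
    (hD : Differentiable ℂ D) (hN : Differentiable ℂ N) :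
    MeromorphicOn (quotientForm z D N) Set.univ := fun s _ =>
  (((differentiable_totalIm_cpow hz).analyticAt s).meromorphicAt.div
    (hD.analyticAt s).meromorphicAt).mul (hN.analyticAt s).meromorphicAt

theorem toMeromorphicNFOn_quotientForm_eq (hz : z ∈ periodDomain v r) {D N : ℂ → ℂ}
    (hD : Differentiable ℂ D) (hN : Differentiable ℂ N) {s : ℂ} (hs : D s ≠ 0) :
    toMeromorphicNFOn (quotientForm z D N) Set.univ s = quotientForm z D N s := by
  rw [toMeromorphicNFOn_eq_toMeromorphicNFAt (meromorphicOn_quotientForm hz hD hN) (Set.mem_univ s),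
    toMeromorphicNFAt_eq_self.2 (analyticAt_quotientForm hz hD hN hs).meromorphicNFAt]

theorem tsum_eisTerm (s : ℂ) (hs : s ≠ 0) :
    ∑' l : {l : v.CInf // l ∈ lattice Y z ∧ l ≠ 0}, eisTerm z s l =
      (totalIm z : ℂ) ^ s * ∑' l : lattice Y z, 1 / (‖(l : v.CInf)‖ : ℂ) ^ ((r : ℂ) * s) := by
  have hr : (r : ℂ) * s ≠ 0 := mul_ne_zero (by exact_mod_cast NeZero.ne r) hs
  rw [← tsum_nonzero_eq (g := fun l => 1 / (‖l‖ : ℂ) ^ ((r : ℂ) * s)) (by simp [hr]),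
    ← tsum_mul_left]
  exact tsum_congr fun l => div_eq_mul_one_div _ _

theorem isEisenstein_toMeromorphicNFOn (hz : z ∈ periodDomain v r) {D N : ℂ → ℂ}
    (hD : Differentiable ℂ D) (hN : Differentiable ℂ N) (hD0 : ∀ s : ℂ, 1 < s.re → D s ≠ 0)
    (hDN : ∀ s : ℂ, 1 < s.re →
      D s * ∑' l : lattice Y z, 1 / (‖(l : v.CInf)‖ : ℂ) ^ ((r : ℂ) * s) = N s) :
    IsEisenstein Y z (toMeromorphicNFOn (quotientForm z D N) Set.univ) := by
  refine ⟨meromorphicNFOn_toMeromorphicNFOn _ _, fun s hs => ?_⟩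
  have hs0 : s ≠ 0 := by rintro rfl; simp at hs; linarith
  rw [toMeromorphicNFOn_quotientForm_eq hz hD hN (hD0 s hs), tsum_eisTerm s hs0, quotientForm,
    ← hDN s hs, ← mul_assoc, div_mul_cancel₀ _ (hD0 s hs)]

/-- By uniqueness, any entire `D`, `N` with `D * S = N` on `Re s > 1` describe the same `E`, so both
functional equations can be read off one continuation. -/
theorem IsEisenstein.eq_quotientForm {E : ℂ → ℂ} (hE : IsEisenstein Y z E)
    (hz : z ∈ periodDomain v r) {D N : ℂ → ℂ}
    (hD : Differentiable ℂ D) (hN : Differentiable ℂ N) (hD0 : ∀ s : ℂ, 1 < s.re → D s ≠ 0)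
    (hDN : ∀ s : ℂ, 1 < s.re →
      D s * ∑' l : lattice Y z, 1 / (‖(l : v.CInf)‖ : ℂ) ^ ((r : ℂ) * s) = N s)
    {s : ℂ} (hs : D s ≠ 0) : E s = quotientForm z D N s := by
  rw [hE.unique (isEisenstein_toMeromorphicNFOn hz hD hN hD0 hDN),
    toMeromorphicNFOn_quotientForm_eq hz hD hN hs]

end Continuation

/-! ### Scaling the lattice by `a` and the resulting identities between sums. -/

section FunctionalEquation

variable {k : Type*} [Field k] {v : Place k}

theorem one_div_norm_zero_cpow {r s : ℂ} (h : r * s ≠ 0) :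
    1 / (((0 : ℝ) : ℂ)) ^ (r * s) = 0 := by
  simp [h]

theorem one_div_mul_cpow {c x : ℝ} (hc : 0 ≤ c) (hx : 0 ≤ x) (t : ℂ) :
    1 / ((c * x : ℝ) : ℂ) ^ t = 1 / (c : ℂ) ^ t * (1 / (x : ℂ) ^ t) := by
  rw [Complex.ofReal_mul, Complex.mul_cpow_ofReal_nonneg hc hx, one_div_mul_one_div]

theorem summable_one_div_cpow {a : k} (ha1 : 1 < v.abs a)
    {L : AddSubgroup v.CInf} (hfin : ∀ ρ : ℝ, {l : v.CInf | l ∈ L ∧ ‖l‖ ≤ ρ}.Finite)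
    (haL : mulLattice a L ≤ L) {r : ℕ} (hr : r ≠ 0)
    (hQ : ((mulLattice a L).relIndex L : ℝ) = v.abs a ^ r) {s : ℂ} (hs : 1 < s.re) :
    Summable fun l : L => 1 / (‖(l : v.CInf)‖ : ℂ) ^ ((r : ℂ) * s) := by
  have hr0 : (0 : ℝ) < r := by exact_mod_cast Nat.pos_of_ne_zero hr
  have hs0 : (r : ℂ) * s ≠ 0 := mul_ne_zero (by exact_mod_cast hr) fun h => by
    rw [h, Complex.zero_re] at hs; linarith
  refine (summable_nonzero_iff (g := fun l : v.CInf => 1 / (‖l‖ : ℂ) ^ ((r : ℂ) * s))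
    (by simp only [norm_zero]; exact one_div_norm_zero_cpow hs0)).1 (Summable.of_norm ?_)
  have h0 : (mulLattice a L).relIndex L ≠ 0 := fun h => by
    rw [h, Nat.cast_zero] at hQ
    exact (pow_pos (zero_lt_one.trans ha1) r).ne hQ
  refine (summable_norm_rpow ha1 hfin haL h0 (t := r * s.re) ?_ (by nlinarith)).congr fun l => ?_
  · rw [hQ, ← Real.rpow_natCast]
    exact Real.rpow_lt_rpow_of_exponent_lt ha1 (by nlinarith)
  · have hl := norm_pos_iff.2 l.2.2
    rw [norm_div, norm_one, Complex.norm_cpow_eq_rpow_re_of_pos hl, Real.rpow_neg hl.le, one_div]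
    simp

theorem tsum_mulLattice {a : k} (ha : a ≠ 0) (L : AddSubgroup v.CInf) (t : ℂ) :
    ∑' l : mulLattice a L, 1 / (‖(l : v.CInf)‖ : ℂ) ^ t =
      1 / (v.abs a : ℂ) ^ t * ∑' l : L, 1 / (‖(l : v.CInf)‖ : ℂ) ^ t := by
  rw [← (mulLatticeEquiv ha L).tsum_eq, ← tsum_mul_left]
  refine tsum_congr fun l => ?_
  rw [norm_mulLatticeEquiv, one_div_mul_cpow (v.abs.nonneg _) (norm_nonneg _)]

theorem summable_mulLattice {a : k} (ha : a ≠ 0) {L : AddSubgroup v.CInf} {t : ℂ}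
    (hL : Summable fun l : L => 1 / (‖(l : v.CInf)‖ : ℂ) ^ t) :
    Summable fun l : mulLattice a L => 1 / (‖(l : v.CInf)‖ : ℂ) ^ t := by
  rw [← (mulLatticeEquiv ha L).summable_iff]
  refine (hL.mul_left (1 / (v.abs a : ℂ) ^ t)).congr fun l => ?_
  rw [Function.comp_apply, norm_mulLatticeEquiv, one_div_mul_cpow (v.abs.nonneg _) (norm_nonneg _)]

theorem finite_latQuot {L M : AddSubgroup v.CInf} (h : L.relIndex M ≠ 0) :
    Finite (LatQuot M L) := AddSubgroup.index_ne_zero_iff_finite.1 h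

theorem tsum_eq_index_mul_add_cosetSum_mulLattice {a : k} (ha : a ≠ 0) {L : AddSubgroup v.CInf}
    (hfin : ∀ ρ : ℝ, {l : v.CInf | l ∈ L ∧ ‖l‖ ≤ ρ}.Finite)
    (haL : mulLattice a L ≤ L) [Finite (LatQuot L (mulLattice a L))]
    {σ : LatQuot L (mulLattice a L) → L} (hσ : ∀ c, QuotientAddGroup.mk (σ c) = c) {t : ℂ}
    (ht : t ≠ 0) (hL : Summable fun l : L => 1 / (‖(l : v.CInf)‖ : ℂ) ^ t) :
    ∑' l : L, 1 / (‖(l : v.CInf)‖ : ℂ) ^ t =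
      (mulLattice a L).relIndex L * (1 / (v.abs a : ℂ) ^ t *
        ∑' l : L, 1 / (‖(l : v.CInf)‖ : ℂ) ^ t) +
      cosetSum L (mulLattice a L) σ fun x => 1 / (x : ℂ) ^ t := by
  rw [← tsum_mulLattice ha]
  exact tsum_eq_cosetSum_add (g := fun x => 1 / (x : ℂ) ^ t) haL
    (fun ρ => (hfin ρ).subset fun l hl => ⟨haL hl.1, hl.2⟩) hσ (by simp [ht]) hL

/-- Apply the coset decomposition to `L ⊆ a⁻¹L`, where scaling multiplies the sum by `|a|^t`. -/
theorem abs_cpow_mul_tsum_eq {a : k} (ha : a ≠ 0) {L : AddSubgroup v.CInf}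
    (hfin : ∀ ρ : ℝ, {l : v.CInf | l ∈ L ∧ ‖l‖ ≤ ρ}.Finite)
    (haL : L ≤ divLattice a L) [Finite (LatQuot (divLattice a L) L)]
    {σ : LatQuot (divLattice a L) L → divLattice a L} (hσ : ∀ c, QuotientAddGroup.mk (σ c) = c)
    {t : ℂ} (ht : t ≠ 0) (hL : Summable fun l : L => 1 / (‖(l : v.CInf)‖ : ℂ) ^ t) :
    (v.abs a : ℂ) ^ t * ∑' l : L, 1 / (‖(l : v.CInf)‖ : ℂ) ^ t =
      L.relIndex (divLattice a L) * ∑' l : L, 1 / (‖(l : v.CInf)‖ : ℂ) ^ t +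
      cosetSum (divLattice a L) L σ fun x => 1 / (x : ℂ) ^ t := by
  have hM := summable_mulLattice (inv_ne_zero ha) hL
  have h := tsum_mulLattice (inv_ne_zero ha) L t
  have habs : (v.abs a : ℂ) ^ t ≠ 0 := by
    rw [Ne, Complex.cpow_eq_zero_iff]
    simp [ha]
  have hinv : 1 / (v.abs a⁻¹ : ℂ) ^ t = (v.abs a : ℂ) ^ t := by
    have h1 := one_div_mul_cpow (v.abs.nonneg a) (v.abs.nonneg a⁻¹) t
    rw [← map_mul, mul_inv_cancel₀ ha, map_one, Complex.ofReal_one, Complex.one_cpow,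
      div_one] at h1
    field_simp at h1 ⊢
    exact h1.symm
  rw [hinv, mulLattice_inv ha] at h
  rw [mulLattice_inv ha] at hM
  rw [← h]
  exact tsum_eq_cosetSum_add (g := fun x => 1 / (x : ℂ) ^ t) haL hfin hσ (by simp [ht]) hM

/-- The denominators of the two formulas differ by a nonvanishing factor, so nonvanishing for `Re s
> 1` passes from one to the other. -/
theorem one_sub_cpow_eq (r : ℕ) {b : ℝ} (hb : 0 < b) (s : ℂ) :
    1 - (b : ℂ) ^ ((r : ℂ) * (1 - s)) =
      1 / (b : ℂ) ^ ((r : ℂ) * s) * ((b : ℂ) ^ ((r : ℂ) * s) - (b : ℂ) ^ r) := by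
  have hb' : (b : ℂ) ≠ 0 := by exact_mod_cast hb.ne'
  have h0 : (b : ℂ) ^ ((r : ℂ) * s) ≠ 0 := by simp [Complex.cpow_eq_zero_iff, hb']
  rw [mul_sub, mul_one, Complex.cpow_sub _ _ hb', Complex.cpow_natCast]
  field_simp

theorem differentiable_cosetSum (r : ℂ) {L M : AddSubgroup v.CInf}
    (hfin : ∀ ρ : ℝ, {l : v.CInf | l ∈ L ∧ ‖l‖ ≤ ρ}.Finite) [Finite (LatQuot M L)]
    {σ : LatQuot M L → M} (hσ : ∀ c, QuotientAddGroup.mk (σ c) = c) :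
    Differentiable ℂ fun s : ℂ => cosetSum M L σ fun x => 1 / (x : ℂ) ^ (r * s) :=
  (differentiable_and_iteratedDeriv_of_mem_posEvalSpan r (cosetSum_mem_posEvalSpan hfin hσ)).1

end FunctionalEquation

/-! ### The explicit formula and the derivatives at zero for a scaling `a`. -/

section Consequences

variable {k : Type*} [Field k] {v : Place k} {r : ℕ} [NeZero r]
  {Y : Submodule v.ringAway (Fin r → k)} {z : Projectivization v.CInf (Fin r → v.CInf)}

theorem mulLattice_lattice_le {a : k} (ha : a ∈ v.ringAway) :
    mulLattice a (lattice Y z) ≤ lattice Y z := by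
  rintro _ ⟨_, ⟨y, hy, rfl⟩, rfl⟩
  exact ⟨a • y, Y.smul_mem ⟨a, ha⟩ hy, evalMap_smul z a y⟩

theorem lattice_le_divLattice {a : k} (ha : a ∈ v.ringAway) :
    lattice Y z ≤ divLattice a (lattice Y z) := fun l hl =>
  mulLattice_lattice_le ha ⟨l, hl, rfl⟩

theorem re_ne_zero_of_one_lt {s : ℂ} (hs : 1 < s.re) : s ≠ 0 := by
  rintro rfl
  simp at hs
  linarith

theorem natCast_mul_ne_zero {s : ℂ} (hs : 1 < s.re) : (r : ℂ) * s ≠ 0 :=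
  mul_ne_zero (by exact_mod_cast NeZero.ne r) (re_ne_zero_of_one_lt hs)

theorem summable_eisTerm {s : ℂ} (hs : 1 < s.re)
    (h : Summable fun l : lattice Y z => 1 / (‖(l : v.CInf)‖ : ℂ) ^ ((r : ℂ) * s)) :
    Summable fun l : {l : v.CInf // l ∈ lattice Y z ∧ l ≠ 0} => eisTerm z s (l : v.CInf) := by
  refine ((summable_nonzero_iff (g := fun l : v.CInf => 1 / (‖l‖ : ℂ) ^ ((r : ℂ) * s)) ?_).2
    h).mul_left ((totalIm z : ℂ) ^ s) |>.congr fun l => (div_eq_mul_one_div _ _).symm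
  simp only [norm_zero]
  exact one_div_norm_zero_cpow (natCast_mul_ne_zero hs)

theorem cpow_sub_ne_zero {b : ℝ} (hb : 1 < b) {s : ℂ} (hs : 1 < s.re) :
    (b : ℂ) ^ ((r : ℂ) * s) - (b : ℂ) ^ r ≠ 0 := by
  have hr : (0 : ℝ) < r := by exact_mod_cast Nat.pos_of_ne_zero (NeZero.ne r)
  intro h
  have h1 := congrArg norm (sub_eq_zero.1 h)
  rw [Complex.norm_cpow_eq_rpow_re_of_pos (zero_lt_one.trans hb), norm_pow, Complex.norm_real,
    Real.norm_of_nonneg (zero_lt_one.trans hb).le, ← Real.rpow_natCast] at h1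
  have h2 := Real.rpow_lt_rpow_of_exponent_lt hb
    (show (r : ℝ) < ((r : ℂ) * s).re by simp; nlinarith)
  exact h2.ne' h1

theorem differentiable_const_cpow_mul {b : ℝ} (hb : 0 < b) (r : ℂ) :
    Differentiable ℂ fun s : ℂ => (b : ℂ) ^ (r * s) := fun _ =>
  (differentiableAt_id.const_mul r).const_cpow (Or.inl (by exact_mod_cast hb.ne'))

/-- The properties of the lattice `Λ` and the scalar `a` on which the Eisenstein series rests. -/
structure IsScaling (Y : Submodule v.ringAway (Fin r → k))
    (z : Projectivization v.CInf (Fin r → v.CInf)) (a : k) : Prop where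
  mem : a ∈ v.ringAway
  one_lt : 1 < v.abs a
  relIndex_eq : ((mulLattice a (lattice Y z)).relIndex (lattice Y z) : ℝ) = v.abs a ^ r

namespace IsScaling

variable {a : k} (h : IsScaling Y z a)
  (hfin : ∀ ρ : ℝ, {l : v.CInf | l ∈ lattice Y z ∧ ‖l‖ ≤ ρ}.Finite) (hz : z ∈ periodDomain v r)

include h

theorem ne_zero : a ≠ 0 := by
  rintro rfl
  have := h.one_lt
  rw [map_zero] at this
  linarith

theorem relIndex_ne_zero : (mulLattice a (lattice Y z)).relIndex (lattice Y z) ≠ 0 := fun h0 => by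
  have := h.relIndex_eq
  rw [h0, Nat.cast_zero] at this
  exact (pow_pos (zero_lt_one.trans h.one_lt) r).ne this

theorem relIndex_cast : ((mulLattice a (lattice Y z)).relIndex (lattice Y z) : ℂ) =
    (v.abs a : ℂ) ^ r := by exact_mod_cast congrArg (fun x : ℝ => (x : ℂ)) h.relIndex_eq

theorem finite_quot : Finite (LatQuot (lattice Y z) (mulLattice a (lattice Y z))) :=
  finite_latQuot h.relIndex_ne_zero

theorem finite_div_quot : Finite (LatQuot (divLattice a (lattice Y z)) (lattice Y z)) :=
  finite_latQuot ((relIndex_divLattice h.ne_zero _).trans_ne h.relIndex_ne_zero)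

include hfin

theorem finite_mulLattice (ρ : ℝ) :
    {l : v.CInf | l ∈ mulLattice a (lattice Y z) ∧ ‖l‖ ≤ ρ}.Finite :=
  (hfin ρ).subset fun _ hl => ⟨mulLattice_lattice_le h.mem hl.1, hl.2⟩

theorem summable {s : ℂ} (hs : 1 < s.re) :
    Summable fun l : lattice Y z => 1 / (‖(l : v.CInf)‖ : ℂ) ^ ((r : ℂ) * s) :=
  summable_one_div_cpow h.one_lt hfin (mulLattice_lattice_le h.mem) (NeZero.ne r) h.relIndex_eq hs

/-- The index equals `|a|^r`, so moving its term to the left produces the factor. -/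
theorem sub_mul_tsum_eq_cosetSum
    {σ : LatQuot (divLattice a (lattice Y z)) (lattice Y z) → divLattice a (lattice Y z)}
    (hσ : ∀ c, QuotientAddGroup.mk (σ c) = c) {s : ℂ} (hs : 1 < s.re) :
    ((v.abs a : ℂ) ^ ((r : ℂ) * s) - (v.abs a : ℂ) ^ r) *
      ∑' l : lattice Y z, 1 / (‖(l : v.CInf)‖ : ℂ) ^ ((r : ℂ) * s) =
      cosetSum (divLattice a (lattice Y z)) (lattice Y z) σ
        fun x => 1 / (x : ℂ) ^ ((r : ℂ) * s) := by
  have := h.finite_div_quot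
  rw [sub_mul, abs_cpow_mul_tsum_eq h.ne_zero hfin (lattice_le_divLattice h.mem) hσ
    (natCast_mul_ne_zero hs) (h.summable hfin hs), relIndex_divLattice h.ne_zero, h.relIndex_cast]
  ring

theorem one_sub_mul_tsum_eq_cosetSum
    {σ : LatQuot (lattice Y z) (mulLattice a (lattice Y z)) → lattice Y z}
    (hσ : ∀ c, QuotientAddGroup.mk (σ c) = c) {s : ℂ} (hs : 1 < s.re) :
    (1 - (v.abs a : ℂ) ^ ((r : ℂ) * (1 - s))) *
      ∑' l : lattice Y z, 1 / (‖(l : v.CInf)‖ : ℂ) ^ ((r : ℂ) * s) =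
      cosetSum (lattice Y z) (mulLattice a (lattice Y z)) σ
        fun x => 1 / (x : ℂ) ^ ((r : ℂ) * s) := by
  have := h.finite_quot
  have key := tsum_eq_index_mul_add_cosetSum_mulLattice h.ne_zero hfin (mulLattice_lattice_le h.mem)
    hσ (natCast_mul_ne_zero hs) (h.summable hfin hs)
  have hb : (v.abs a : ℂ) ≠ 0 := by exact_mod_cast (zero_lt_one.trans h.one_lt).ne'
  rw [h.relIndex_cast] at key
  rw [sub_mul, one_mul, sub_eq_iff_eq_add]
  nth_rw 1 [key]
  rw [mul_sub, mul_one, Complex.cpow_sub _ _ hb, Complex.cpow_natCast]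
  ring

include hz

theorem exists_isEisenstein : ∃ E, IsEisenstein Y z E := by
  have := h.finite_div_quot
  have hσ : ∀ c : LatQuot (divLattice a (lattice Y z)) (lattice Y z),
      QuotientAddGroup.mk (Quotient.out c) = c := fun c => Quotient.out_eq c
  exact ⟨_, isEisenstein_toMeromorphicNFOn hz
    ((differentiable_const_cpow_mul (zero_lt_one.trans h.one_lt) r).sub_const _)
    (differentiable_cosetSum r hfin hσ) (fun s hs => cpow_sub_ne_zero h.one_lt hs)
    fun s hs => h.sub_mul_tsum_eq_cosetSum hfin hσ hs⟩

variable {E : ℂ → ℂ} (hE : IsEisenstein Y z E)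

include hE

theorem eisenstein_eq
    {σ : LatQuot (divLattice a (lattice Y z)) (lattice Y z) → divLattice a (lattice Y z)}
    (hσ : ∀ c, QuotientAddGroup.mk (σ c) = c) {s : ℂ}
    (hs : (v.abs a : ℂ) ^ ((r : ℂ) * s) ≠ (v.abs a : ℂ) ^ r) :
    E s = (totalIm z : ℂ) ^ s / ((v.abs a : ℂ) ^ ((r : ℂ) * s) - (v.abs a : ℂ) ^ r) *
      cosetSum (divLattice a (lattice Y z)) (lattice Y z) σ
        fun x => 1 / (x : ℂ) ^ ((r : ℂ) * s) := by
  have := h.finite_div_quot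
  exact hE.eq_quotientForm hz
    ((differentiable_const_cpow_mul (zero_lt_one.trans h.one_lt) r).sub_const _)
    (differentiable_cosetSum r hfin hσ) (fun s hs => cpow_sub_ne_zero h.one_lt hs)
    (fun s hs => h.sub_mul_tsum_eq_cosetSum hfin hσ hs) (sub_ne_zero.2 hs)

theorem eventuallyEq_cosetSum
    {σ : LatQuot (lattice Y z) (mulLattice a (lattice Y z)) → lattice Y z}
    (hσ : ∀ c, QuotientAddGroup.mk (σ c) = c) :
    (fun s : ℂ => (1 - (v.abs a : ℂ) ^ ((r : ℂ) * (1 - s))) / (totalIm z : ℂ) ^ s * E s) =ᶠ[𝓝 0]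
      fun s => cosetSum (lattice Y z) (mulLattice a (lattice Y z)) σ
        fun x => 1 / (x : ℂ) ^ ((r : ℂ) * s) := by
  have := h.finite_quot
  have hb := zero_lt_one.trans h.one_lt
  have hD : Differentiable ℂ fun s : ℂ => 1 - (v.abs a : ℂ) ^ ((r : ℂ) * (1 - s)) :=
    ((differentiable_const_cpow_mul hb r).comp (differentiable_id.const_sub 1)).const_sub 1
  have hD1 : ∀ s : ℂ, 1 < s.re → 1 - (v.abs a : ℂ) ^ ((r : ℂ) * (1 - s)) ≠ 0 := fun s hs => by
    rw [one_sub_cpow_eq r hb]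
    refine mul_ne_zero (one_div_ne_zero ?_) (cpow_sub_ne_zero h.one_lt hs)
    simp [Complex.cpow_eq_zero_iff, hb.ne']
  have hD0 : 1 - (v.abs a : ℂ) ^ ((r : ℂ) * (1 - 0)) ≠ 0 := by
    rw [sub_zero, mul_one, Complex.cpow_natCast, sub_ne_zero]
    exact_mod_cast (one_lt_pow₀ h.one_lt (NeZero.ne r)).ne
  -- At `s = 0` the factor is `1 - |a|^r ≠ 0`, so the quotient formula holds near `0`.
  filter_upwards [hD.continuous.continuousAt.eventually_ne hD0] with s hs
  have hIm : (totalIm z : ℂ) ^ s ≠ 0 := by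
    simp [Complex.cpow_eq_zero_iff, (totalIm_pos hz).ne']
  rw [hE.eq_quotientForm hz hD (differentiable_cosetSum r (h.finite_mulLattice hfin) hσ)
    hD1 (fun s hs => h.one_sub_mul_tsum_eq_cosetSum hfin hσ hs) hs, quotientForm]
  field_simp

theorem analyticAt_zero : AnalyticAt ℂ (fun s : ℂ => (1 - (v.abs a : ℂ) ^ ((r : ℂ) * (1 - s))) /
    (totalIm z : ℂ) ^ s * E s) 0 := by
  have := h.finite_quot
  have hσ : ∀ c : LatQuot (lattice Y z) (mulLattice a (lattice Y z)),
      QuotientAddGroup.mk (Quotient.out c) = c := fun c => Quotient.out_eq c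
  exact ((differentiable_cosetSum r (h.finite_mulLattice hfin) hσ).analyticAt 0).congr
    (h.eventuallyEq_cosetSum hfin hz hE hσ).symm

theorem iteratedDeriv_zero
    {σ : LatQuot (lattice Y z) (mulLattice a (lattice Y z)) → lattice Y z}
    (hσ : ∀ c, QuotientAddGroup.mk (σ c) = c) (n : ℕ) :
    iteratedDeriv n (fun s : ℂ => (1 - (v.abs a : ℂ) ^ ((r : ℂ) * (1 - s))) /
      (totalIm z : ℂ) ^ s * E s) 0 =
      (-(r : ℂ)) ^ n * cosetSum (lattice Y z) (mulLattice a (lattice Y z)) σ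
        fun x => ((Real.log x ^ n : ℝ) : ℂ) := by
  have := h.finite_quot
  rw [(h.eventuallyEq_cosetSum hfin hz hE hσ).iteratedDeriv_eq]
  exact (differentiable_and_iteratedDeriv_of_mem_posEvalSpan r (cosetSum_mem_posEvalSpan
    (h.finite_mulLattice hfin) hσ)).2 n

end IsScaling

theorem exists_isEisenstein_of_finite (hz : z ∈ periodDomain v r) [Finite (lattice Y z)] :
    ∃ E, IsEisenstein Y z E := by
  classical
  have := Fintype.ofFinite (lattice Y z)
  have hN : Differentiable ℂ fun s : ℂ => ∑ l : lattice Y z,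
      -- The zero vector is removed by hand: `1 / 0^(rs)` vanishes for `s ≠ 0` but is `1` at `s =
      -- 0`, which would break differentiability.
      if (l : v.CInf) = 0 then 0 else 1 / (‖(l : v.CInf)‖ : ℂ) ^ ((r : ℂ) * s) := by
    refine Differentiable.fun_sum fun l _ => ?_
    split_ifs with hl
    · exact differentiable_const _
    · simp only [one_div_cpow_eq_cexp (norm_pos_iff.2 hl)]
      fun_prop
  refine ⟨_, isEisenstein_toMeromorphicNFOn hz (differentiable_const 1) hN
    (fun _ _ => one_ne_zero) fun s hs => ?_⟩
  rw [one_mul, tsum_fintype]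
  refine Finset.sum_congr rfl fun l _ => ?_
  split_ifs with hl
  · rw [hl, norm_zero]
    exact one_div_norm_zero_cpow (natCast_mul_ne_zero hs)
  · rfl

end Consequences

/-! ### Verification of the scaling properties for nonconstant elements of `A`. -/

section Main

variable {F k : Type*} [Field F] [Finite F] [Field k] [Algebra F k]
  {v : Place k} {r : ℕ} [NeZero r] {Y : Submodule v.ringAway (Fin r → k)}
  {z : Projectivization v.CInf (Fin r → v.CInf)}

theorem finite_lattice_of_ringAway_subset (hA : ∀ x ∈ v.ringAway, x ∈ Set.range (algebraMap F k))
    [Module.Finite v.ringAway Y] : Finite (lattice Y z) := by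
  have : Finite v.ringAway := (Set.finite_range (algebraMap F k)).subset hA
  have : Finite Y := Module.finite_of_finite v.ringAway
  exact Set.Finite.image (evalMap z) (show (Y : Set (Fin r → k)).Finite from Set.toFinite _)

theorem isScaling_and_finite (hfg : (⊤ : IntermediateField F k).FG)
    (htr : Algebra.trdeg F k = 1) (hconst : algebraicClosure F k = ⊥)
    [Module.Finite v.ringAway Y] (hrank : Module.finrank v.ringAway Y = r)
    (hz : z ∈ periodDomain v r) {a : k} (ha : a ∈ v.ringAway)
    (ha' : a ∉ Set.range (algebraMap F k)) :
    IsScaling Y z a ∧ ∀ ρ : ℝ, {l : v.CInf | l ∈ lattice Y z ∧ ‖l‖ ≤ ρ}.Finite := by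
  have hta := transcendental_of_notMem_range hconst ha'
  have ha1 := Place.one_lt_val_of_mem_ringAway hfg htr hconst ha ha'
  have := finiteDimensional_adjoin_of_transcendental hfg htr hta
  have := v.finite_residueField (F := F) ha1
  have hfrac := Place.exists_mul_mem_ringAway htr ha hta
  have := Place.isFractionRing_ringAway fun y => by
    obtain ⟨d, hd, h⟩ := hfrac y
    exact ⟨d, Place.adjoin_le_ringAway ha hd, h⟩
  have htop := Place.exists_sup_piBall_eq_top Y (NeZero.ne r) hrank
    (Place.exists_sup_ball_eq_top ha ha1 hfrac)
  have hfin := Place.finite_inf_piBall Y (Place.finite_inf_ball hfg htr hconst v)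
  have ha0 : v.val a ≠ 0 := (zero_lt_one.trans ha1).ne'
  rw [← WithZero.exp_log ha0, ← WithZero.exp_zero, WithZero.exp_lt_exp] at ha1
  -- Here `n` is the pole order of `a` at `∞`, so `|a| = q^n` and the index `(q^n)^r` is `|a|^r`.
  obtain ⟨n, hn⟩ := Int.eq_ofNat_of_zero_le ha1.le
  have hval : v.val a = exp (n : ℤ) := by rw [← hn, WithZero.exp_log ha0]
  have habs : v.abs a = (v.q : ℝ) ^ n := by
    rw [v.abs_eq_zpow hval, zpow_natCast, v.base_eq_q, NNReal.coe_natCast]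
  refine ⟨⟨ha, ?_, ?_⟩, finite_lattice_inf_ball hz Y hfin⟩
  · rw [habs]
    exact one_lt_pow₀ (by exact_mod_cast v.two_le_q) (by omega)
  · rw [relIndex_mulLattice hz, Place.relIndex_smul_eq Y htop hfin ha hval, habs]
    push_cast
    rfl

end Main

end DrinfeldEisenstein

open DrinfeldEisenstein
theorem corollary2p11 (F k : Type*) [Field F] [Finite F] [Field k] [Algebra F k]
    (hfg : (⊤ : IntermediateField F k).FG) (htr : Algebra.trdeg F k = 1)
    (hconst : algebraicClosure F k = ⊥)
    (v : Place k) (r : ℕ) [NeZero r]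
    (Y : Submodule v.ringAway (Fin r → k))
    (hproj : Module.Projective v.ringAway Y) (hrank : Module.finrank v.ringAway Y = r)
    (z : Projectivization v.CInf (Fin r → v.CInf))
    (hz : z ∈ periodDomain v r) :
    -- each ball contains only finitely many lattice elements
    (∀ ρ : ℝ, {l : v.CInf | l ∈ lattice Y z ∧ ‖l‖ ≤ ρ}.Finite) ∧
    -- the Eisenstein series converges absolutely for `Re s > 1` and has a continuation
    (∀ s : ℂ, 1 < s.re →
      Summable fun l : {l : v.CInf // l ∈ lattice Y z ∧ l ≠ 0} =>
        eisTerm z s (l : v.CInf)) ∧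
    (∃! E : ℂ → ℂ, IsEisenstein Y z E) ∧
    ∀ E : ℂ → ℂ, IsEisenstein Y z E →
    ∀ a ∈ v.ringAway, a ∉ Set.range (algebraMap F k) →
      -- the explicit form of the continuation
      (Finite (LatQuot (divLattice a (lattice Y z)) (lattice Y z)) ∧
        ∀ σ : LatQuot (divLattice a (lattice Y z)) (lattice Y z) → divLattice a (lattice Y z),
          (∀ c, QuotientAddGroup.mk (σ c) = c) →
          ∀ s : ℂ, (v.abs a : ℂ) ^ ((r : ℂ) * s) ≠ (v.abs a : ℂ) ^ r →
            E s = (totalIm z : ℂ) ^ s /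
                ((v.abs a : ℂ) ^ ((r : ℂ) * s) - (v.abs a : ℂ) ^ r) *
              cosetSum (divLattice a (lattice Y z)) (lattice Y z) σ (fun x => 1 / (x : ℂ) ^ ((r : ℂ) * s))) ∧
      -- the Taylor coefficients at `s = 0`
      (Finite (LatQuot (lattice Y z) (mulLattice a (lattice Y z))) ∧
        AnalyticAt ℂ (fun s : ℂ => (1 - (v.abs a : ℂ) ^ ((r : ℂ) * (1 - s))) /
          (totalIm z : ℂ) ^ s * E s) 0 ∧
        ∀ σ : LatQuot (lattice Y z) (mulLattice a (lattice Y z)) → lattice Y z,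
          (∀ c, QuotientAddGroup.mk (σ c) = c) →
          ∀ n : ℕ,
            iteratedDeriv n (fun s : ℂ => (1 - (v.abs a : ℂ) ^ ((r : ℂ) * (1 - s))) /
                (totalIm z : ℂ) ^ s * E s) 0 =
              (-(r : ℂ)) ^ n *
                cosetSum (lattice Y z) (mulLattice a (lattice Y z)) σ
                  (fun x => ((Real.log x ^ n : ℝ) : ℂ))) := by
  
  have := module_finite_of_projective_of_finrank_ne_zero (hrank.trans_ne (NeZero.ne r))
  -- If `A` had only constants, `Λ` would be finite and the claims about `a` vacuous; treating this
  -- case separately avoids proving that `A` has nonconstant elements.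
  by_cases hA : ∀ x ∈ v.ringAway, x ∈ Set.range (algebraMap F k)
  · have := finite_lattice_of_ringAway_subset (Y := Y) (z := z) hA
    obtain ⟨E, hE⟩ := exists_isEisenstein_of_finite (Y := Y) hz
    exact ⟨fun ρ => Set.Finite.subset this fun l hl => hl.1,
      fun s hs => summable_eisTerm hs Summable.of_finite,
      ⟨E, hE, fun E' hE' => hE'.unique hE⟩, fun E hE a ha ha' => absurd (hA a ha) ha'⟩
  · push Not at hA
    have key := fun (a : k) (ha : a ∈ v.ringAway) (ha' : a ∉ Set.range (algebraMap F k)) =>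
      isScaling_and_finite hfg htr hconst hrank hz ha ha'
    obtain ⟨a₀, ha₀, ha₀'⟩ := hA
    obtain ⟨h₀, hfin⟩ := key a₀ ha₀ ha₀'
    obtain ⟨E, hE⟩ := h₀.exists_isEisenstein hfin hz
    refine ⟨hfin, fun s hs => summable_eisTerm hs (h₀.summable hfin hs),
      ⟨E, hE, fun E' hE' => hE'.unique hE⟩, fun E hE a ha ha' => ?_⟩
    have h := (key a ha ha').1
    exact ⟨⟨h.finite_div_quot, fun σ hσ s hs => h.eisenstein_eq hfin hz hE hσ hs⟩,
      h.finite_quot, h.analyticAt_zero hfin hz hE,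
      fun σ hσ n => h.iteratedDeriv_zero hfin hz hE hσ n⟩
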